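/- Let $k\ge 1$ be an integer, let $\boldsymbol\alpha=(\alpha_1,\dots,\alpha_k)\in(0,1]^k$ with $\sum_{i}\alpha_i=1$, and let $P=(p_{ij})_{1\le i,j\le k}$ be a symmetric matrix with all entries in $(0,1)$; write $p_i:=p_{ii}$. All of these are fixed. For $n\in\mathbb N$ let $n_i:=\lfloor\alpha_i n\rfloor$ for $i<k$ and $n_k:=n-\sum_{i<k}n_i$. Let $G(n,\boldsymbol\alpha,P)$ be the random graph on a vertex set of size $n$ that is the disjoint union of $V_1,\dots,V_k$ with $|V_i|=n_i$, in which any two distinct vertices $u\in V_i$ and $v\in V_j$ are adjacent with probability $p_{ij}$, independently for all pairs. Let $G(m,p)$ be the binomial random graph on $m$ vertices with edge probability $p$, and let $\chi$ denote the chromatic number. For each $n$ let $G_n\sim G(n,\boldsymbol\alpha,P)$ and $H_{n,i}\sim G(n_i,p_i)$, $1\le i\le k$, be defined on a common probability space, with an arbitrary joint distribution (for example $H_{n,i}=G_n[V_i]$, or all of them independent). Then, with high probability, $$\chi(G_n)=(1+o(1))\sum_{i=1}^k\chi(H_{n,i}),$$ that is, for every $\varepsilon>0$, $$\Pr\Big[\,\Big|\chi(G_n)-\sum_{i=1}^k\chi(H_{n,i})\Big|\le\varepsilon\sum_{i=1}^k\chi(H_{n,i})\Big]\longrightarrow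 1\qquad(n\to\infty),$$ if and only if $p_{ij}\ge 1-\sqrt{(1-p_i)(1-p_j)}$ for all $1\le i<j\le k$. -/

import Mathlib

open MeasureTheory ProbabilityTheory Filter
open scoped Topology unitInterval

noncomputable section

namespace RandomBlockGraph

/-- The size of the `i`-th part of the vertex set: `⌊α i * n⌋` for every part but the last one,
which takes all the remaining ones of the `n` vertices. -/
def blockSize {k : ℕ} (α : Fin k → ℝ) (n : ℕ) (i : Fin k) : ℕ :=
  if (i : ℕ) + 1 = k then n - ∑ j ∈ Finset.univ.filter (fun j : Fin k => (j : ℕ) + 1 < k), ⌊α j * n⌋₊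
  else ⌊α i * n⌋₊

/-- The vertex set `V = V₁ ⊔ ⋯ ⊔ V_k`; a vertex is a pair of the index of its part and its
position in that part. -/
abbrev BlockVertex {k : ℕ} (α : Fin k → ℝ) (n : ℕ) : Type :=
  Σ i : Fin k, Fin (blockSize α n i)

/-- The law of the random graph on the finite vertex set `V` in which every unordered pair `e` of
distinct vertices is an edge with probability `p e`, independently of all other pairs. (One coin is
tossed for every `e : Sym2 V`; `SimpleGraph.fromEdgeSet` ignores the coins on the diagonal.) -/
def independentEdges (V : Type*) [Fintype V] [DecidableEq V] (p : Sym2 V → I) :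
    Measure (SimpleGraph V) :=
  (Measure.pi fun e : Sym2 V => bernoulliMeasure True False (p e)).map
    fun coin => SimpleGraph.fromEdgeSet {e | coin e}

/-- The law of the random block graph `G(n, α, P)`: distinct vertices `u ∈ V_i`, `v ∈ V_j` are
adjacent with probability `P i j`, independently for all pairs. -/
def blockRandom {k : ℕ} (n : ℕ) (α : Fin k → ℝ) (P : Matrix (Fin k) (Fin k) I) (hP : P.IsSymm) :
    Measure (SimpleGraph (BlockVertex α n)) :=
  independentEdges (BlockVertex α n)
    (Sym2.lift ⟨fun u v => P u.1 v.1, fun u v => hP.apply v.1 u.1⟩)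

/-- The chromatic number of a graph on a finite vertex set, as a real number. -/
def chi {V : Type*} [Finite V] (G : SimpleGraph V) : ℝ := (G.chromaticNumber.toNat : ℝ)

/-- With high probability `X n = (1 + o(1)) Y n`: for every `ε > 0`, the probability that
`|X n - Y n| ≤ ε * Y n` tends to one. -/
def WhpAsymptoticallyEq {Ω : ℕ → Type*} [∀ n, MeasurableSpace (Ω n)] (μ : ∀ n, Measure (Ω n))
    (X Y : ∀ n, Ω n → ℝ) : Prop :=
  ∀ ε : ℝ, 0 < ε →
    Tendsto (fun n => μ n {ω | |X n ω - Y n ω| ≤ ε * Y n ω}) atTop (𝓝 1)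

end RandomBlockGraph

end

/-!
Give the pair `uv` the cost `-log (1 - p_uv)` and write `c_i`, `c_ij` for the costs within `V_i` and
between `V_i` and `V_j`. A set of vertices is independent with probability `exp (-cost)`, and the
condition on `P` says `c_ij ≥ (c_i + c_j) / 2` for all `i` and `j`.

If it holds, then a set `S` with weight `w = ∑ v ∈ S, c_v` costs at least `(|S| - 1) w / 2`, so that
by the first moment method no independent set has a weight above `(2 + o(1)) log n`. Summing over
the colour classes, `χ(G) ≥ (1 - o(1)) ∑ i, c_i n_i / (2 log n)`. By Janson's inequality every set
of at least `n / (log n)²` vertices of `V_i` contains an independent set of about `2 log n / c_i`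
vertices, so that greedy colouring of the parts separately attains this bound, for the graphs
`H_{n,i}` as well.

If `c_ij < (c_i + c_j) / 2`, then the cross pairs of a mixed set with about `log n / c_i` vertices
in `V_i` and `log n / c_j` in `V_j` save a cost of order `(log n)²`. Hence Janson's inequality still
finds such sets in all large subsets when their weight is raised to `(2 + η) log n`, and using them
for a positive proportion of the colour classes saves a constant factor.
-/

noncomputable section

namespace RandomBlockGraph

section RandomSubset

variable {E : Type*} [DecidableEq E]

/-- The indicator of the event that the set `A` is disjoint from `Q`. -/
def avoids (Q A : Finset E) : ℝ := if Disjoint Q A then 1 else 0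

lemma avoids_nonneg (Q A : Finset E) : 0 ≤ avoids Q A := by
  unfold avoids; split_ifs <;> simp

lemma avoids_antitone (Q : Finset E) : Antitone (avoids Q) := by
  intro A B h
  by_cases hB : Disjoint Q B
  · simp [avoids, hB, hB.mono_right h]
  · simpa [avoids, hB] using avoids_nonneg Q A

lemma avoids_mul (Q R A : Finset E) : avoids Q A * avoids R A = avoids (Q ∪ R) A := by
  by_cases hQ : Disjoint Q A <;> by_cases hR : Disjoint R A <;>
    simp [avoids, hQ, hR, Finset.disjoint_union_left]

lemma avoids_insert_right {Q : Finset E} {e : E} (he : e ∉ Q) (A : Finset E) :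
    avoids Q (insert e A) = avoids Q A := by
  simp [avoids, Finset.disjoint_insert_right, he]

lemma avoids_mul_apply_sdiff (Q A : Finset E) (f : Finset E → ℝ) :
    avoids Q A * f (A \ Q) = avoids Q A * f A := by
  by_cases h : Disjoint Q A
  · rw [sdiff_eq_left.2 h.symm]
  · simp [avoids, h]

variable [Fintype E]

/-- The probability that a random subset of `E`, containing every `e` independently with
probability `p e`, equals `A`. -/
def subsetWeight (p : E → I) (A : Finset E) : ℝ :=
  ∏ e, if e ∈ A then (p e : ℝ) else 1 - p e

/-- The expectation of `f` at a random subset of `E`, which contains every `e` independently with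
probability `p e`. -/
def subsetMean (p : E → I) (f : Finset E → ℝ) : ℝ := ∑ A, subsetWeight p A * f A

lemma subsetWeight_nonneg (p : E → I) (A : Finset E) : 0 ≤ subsetWeight p A := by
  refine Finset.prod_nonneg fun e _ => ?_
  split_ifs
  · exact unitInterval.nonneg (p e)
  · exact unitInterval.one_minus_nonneg (p e)

lemma subsetWeight_mul (p : E → I) (A B : Finset E) :
    subsetWeight p A * subsetWeight p B = subsetWeight p (A ⊓ B) * subsetWeight p (A ⊔ B) := by
  simp only [subsetWeight, ← Finset.prod_mul_distrib]
  refine Finset.prod_congr rfl fun e _ => ?_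
  by_cases hA : e ∈ A <;> by_cases hB : e ∈ B <;> simp [hA, hB, mul_comm]

lemma sum_subsetWeight (p : E → I) : ∑ A, subsetWeight p A = 1 := by
  have h := Finset.prod_add (fun e => (p e : ℝ)) (fun e => 1 - p e) Finset.univ
  simp only [add_sub_cancel, Finset.prod_const_one, Finset.powerset_univ] at h
  refine Eq.trans (Finset.sum_congr rfl fun A _ => ?_) h.symm
  rw [subsetWeight, Finset.prod_ite]
  congr 2 <;> ext <;> simp

lemma subsetMean_nonneg (p : E → I) {f : Finset E → ℝ} (hf : 0 ≤ f) : 0 ≤ subsetMean p f :=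
  Finset.sum_nonneg fun A _ => mul_nonneg (subsetWeight_nonneg p A) (hf A)

lemma subsetMean_mono (p : E → I) {f g : Finset E → ℝ} (h : f ≤ g) :
    subsetMean p f ≤ subsetMean p g :=
  Finset.sum_le_sum fun A _ => mul_le_mul_of_nonneg_left (h A) (subsetWeight_nonneg p A)

lemma subsetMean_one (p : E → I) : subsetMean p (fun _ => 1) = 1 := by
  simp [subsetMean, sum_subsetWeight]

lemma subsetMean_sum (p : E → I) {ι : Type*} (s : Finset ι) (f : ι → Finset E → ℝ) :
    subsetMean p (fun A => ∑ i ∈ s, f i A) = ∑ i ∈ s, subsetMean p (f i) := by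
  simp only [subsetMean, Finset.mul_sum]
  exact Finset.sum_comm

lemma subsetMean_eq_sum_powerset_erase (p : E → I) (e : E) (f : Finset E → ℝ) :
    subsetMean p f = ∑ A ∈ (Finset.univ.erase e).powerset,
      (∏ x ∈ Finset.univ.erase e, if x ∈ A then (p x : ℝ) else 1 - p x) *
        ((1 - p e) * f A + p e * f (insert e A)) := by
  have h := Finset.sum_powerset_insert (Finset.notMem_erase e Finset.univ)
    fun A => subsetWeight p A * f A
  rw [Finset.insert_erase (Finset.mem_univ e), Finset.powerset_univ,
    ← Finset.sum_add_distrib] at h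
  refine h.trans (Finset.sum_congr rfl fun A hA => ?_)
  have heA : e ∉ A := fun he => by simpa using Finset.mem_powerset.1 hA he
  have hinsert : (∏ x ∈ Finset.univ.erase e, if x ∈ insert e A then (p x : ℝ) else 1 - p x) =
      ∏ x ∈ Finset.univ.erase e, if x ∈ A then (p x : ℝ) else 1 - p x :=
    Finset.prod_congr rfl fun x hx => by simp [Finset.ne_of_mem_erase hx]
  simp only [subsetWeight, ← Finset.mul_prod_erase _ _ (Finset.mem_univ e), heA,
    Finset.mem_insert_self, if_true, if_false, hinsert]
  ring

lemma subsetMean_avoids_mul (p : E → I) (Q : Finset E) {g : Finset E → ℝ}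
    (hg : ∀ e ∈ Q, ∀ A, g (insert e A) = g A) :
    subsetMean p (fun A => avoids Q A * g A) = (∏ e ∈ Q, (1 - p e : ℝ)) * subsetMean p g := by
  induction Q using Finset.induction_on with
  | empty => simp [avoids]
  | insert e Q he ih =>
    rw [Finset.prod_insert he, mul_assoc, ← ih fun x hx => hg x (Finset.mem_insert_of_mem hx),
      subsetMean_eq_sum_powerset_erase p e, subsetMean_eq_sum_powerset_erase p e, Finset.mul_sum]
    refine Finset.sum_congr rfl fun A hA => ?_
    have heA : e ∉ A := fun h => by simpa using Finset.mem_powerset.1 hA h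
    have hA : avoids (insert e Q) A = avoids Q A := by simp [avoids, heA]
    have heA : avoids (insert e Q) (insert e A) = 0 := by simp [avoids]
    rw [hA, heA, avoids_insert_right he, hg e (Finset.mem_insert_self e Q)]
    ring

lemma subsetMean_avoids (p : E → I) (Q : Finset E) :
    subsetMean p (avoids Q) = ∏ e ∈ Q, (1 - p e : ℝ) := by
  simpa [subsetMean_one] using subsetMean_avoids_mul p Q (g := fun _ => 1) (by simp)

lemma harris_inequality (p : E → I) {f g : Finset E → ℝ} (hf₀ : 0 ≤ f) (hg₀ : 0 ≤ g)
    (hf : Monotone f) (hg : Monotone g) :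
    subsetMean p f * subsetMean p g ≤ subsetMean p (fun A => f A * g A) := by
  have h := fkg f g (subsetWeight p) (subsetWeight_nonneg p) hf₀ hg₀ hf hg fun A B =>
    (subsetWeight_mul p A B).le
  rwa [sum_subsetWeight, one_mul] at h

lemma subsetMean_avoids_mul_le (p : E → I) (Q : Finset E) {f g : Finset E → ℝ}
    (hf₀ : 0 ≤ f) (hg₀ : 0 ≤ g) (hf : Monotone f) (hg : Monotone g)
    (hgQ : ∀ e ∈ Q, ∀ A, g (insert e A) = g A) :
    subsetMean p (fun A => avoids Q A * f A) * subsetMean p g ≤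
      subsetMean p (fun A => avoids Q A * (f A * g A)) := by
  -- On the event of avoiding `Q`, the function `f` may be replaced by one not depending on `Q`.
  set f' : Finset E → ℝ := fun A => f (A \ Q)
  have hf' : Monotone f' := fun A B h => hf (Finset.sdiff_subset_sdiff h subset_rfl)
  have hf'Q : ∀ e ∈ Q, ∀ A, f' (insert e A) = f' A := fun e he A => by
    simp only [f', Finset.insert_sdiff_of_mem A he]
  calc subsetMean p (fun A => avoids Q A * f A) * subsetMean p g
      = (∏ e ∈ Q, (1 - p e : ℝ)) * (subsetMean p f' * subsetMean p g) := by
        simp only [← avoids_mul_apply_sdiff Q _ f]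
        rw [subsetMean_avoids_mul p Q hf'Q, mul_assoc]
    _ ≤ (∏ e ∈ Q, (1 - p e : ℝ)) * subsetMean p (fun A => f' A * g A) :=
        mul_le_mul_of_nonneg_left (harris_inequality p (fun A => hf₀ (A \ Q)) hg₀ hf' hg)
          (Finset.prod_nonneg fun e _ => unitInterval.one_minus_nonneg (p e))
    _ = subsetMean p (fun A => avoids Q A * (f A * g A)) := by
        rw [← subsetMean_avoids_mul p Q fun e he A => by rw [hf'Q e he, hgQ e he]]
        simp only [f', ← mul_assoc, avoids_mul_apply_sdiff]

end RandomSubset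

section Janson

variable {E ι : Type*} [DecidableEq E]

/-- The number of those of the sets `Q i`, `i ∈ s`, that are disjoint from `A`. -/
def avoidCount (Q : ι → Finset E) (s : Finset ι) (A : Finset E) : ℝ := ∑ i ∈ s, avoids (Q i) A

lemma avoidCount_nonneg (Q : ι → Finset E) (s : Finset ι) (A : Finset E) :
    0 ≤ avoidCount Q s A :=
  Finset.sum_nonneg fun i _ => avoids_nonneg (Q i) A

lemma monotone_exp_neg_mul_avoidCount (Q : ι → Finset E) (s : Finset ι) {t : ℝ} (ht : 0 ≤ t) :
    Monotone fun A => Real.exp (-t * avoidCount Q s A) := fun _ _ h =>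
  Real.exp_le_exp.2 <| mul_le_mul_of_nonpos_left
    (Finset.sum_le_sum fun i _ => avoids_antitone (Q i) h) (neg_nonpos.2 ht)

variable [Fintype E]

/-- The expected number of the sets `Q i`, `i ∈ s`, that a random set avoids. -/
def avoidMean (p : E → I) (Q : ι → Finset E) (s : Finset ι) : ℝ :=
  ∑ i ∈ s, subsetMean p (avoids (Q i))

/-- The expected number of ordered pairs of intersecting sets `Q i`, `Q j` both of which a random
set avoids (the parameter `Δ` of Janson's inequality, including the pairs with `i = j`). -/
def avoidCorr (p : E → I) (Q : ι → Finset E) (s : Finset ι) : ℝ :=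
  ∑ i ∈ s, ∑ j ∈ s with ¬ Disjoint (Q i) (Q j), subsetMean p (avoids (Q i ∪ Q j))

lemma subsetMean_avoids_sub_le (p : E → I) (Q : ι → Finset E) (s : Finset ι) (R : Finset E)
    (t : ℝ) :
    subsetMean p (avoids R) - t * ∑ j ∈ s, subsetMean p (avoids (R ∪ Q j)) ≤
      subsetMean p fun A => avoids R A * Real.exp (-t * avoidCount Q s A) := by
  have hlin : subsetMean p (avoids R) - t * ∑ j ∈ s, subsetMean p (avoids (R ∪ Q j)) =
      subsetMean p fun A => avoids R A * (-t * avoidCount Q s A + 1) := by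
    rw [← subsetMean_sum]
    simp only [subsetMean, avoidCount, ← avoids_mul, ← Finset.mul_sum]
    rw [Finset.mul_sum, ← Finset.sum_sub_distrib]
    exact Finset.sum_congr rfl fun A _ => by ring
  rw [hlin]
  exact subsetMean_mono p fun A =>
    mul_le_mul_of_nonneg_left (Real.add_one_le_exp _) (avoids_nonneg R A)

/-- The sets disjoint from `Q i` are split off by the Harris inequality, and the exponential of the
remaining ones is linearized. -/
lemma sub_mul_subsetMean_exp_le (p : E → I) (Q : ι → Finset E) (s : Finset ι) (i : ι) {t : ℝ}
    (ht : 0 ≤ t) :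
    (subsetMean p (avoids (Q i)) -
        t * ∑ j ∈ s with ¬ Disjoint (Q i) (Q j), subsetMean p (avoids (Q i ∪ Q j))) *
      subsetMean p (fun A => Real.exp (-t * avoidCount Q s A)) ≤
      subsetMean p fun A => avoids (Q i) A * Real.exp (-t * avoidCount Q s A) := by
  set near := s.filter fun j => ¬ Disjoint (Q i) (Q j)
  set far := s.filter fun j => Disjoint (Q i) (Q j)
  have hexp_nonneg (u : Finset ι) : 0 ≤ fun A => Real.exp (-t * avoidCount Q u A) :=
    fun A => (Real.exp_pos _).le
  have hsplit (A : Finset E) : Real.exp (-t * avoidCount Q s A) =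
      Real.exp (-t * avoidCount Q near A) * Real.exp (-t * avoidCount Q far A) := by
    rw [← Real.exp_add, ← mul_add, add_comm]
    exact congrArg (fun x => Real.exp (-t * x)) (Finset.sum_filter_add_sum_filter_not s _ _).symm
  have hfar : ∀ e ∈ Q i, ∀ A, Real.exp (-t * avoidCount Q far (insert e A)) =
      Real.exp (-t * avoidCount Q far A) := fun e he A => by
    refine congrArg (fun x => Real.exp (-t * x)) (Finset.sum_congr rfl fun j hj => ?_)
    exact avoids_insert_right (Finset.disjoint_left.1 (Finset.mem_filter.1 hj).2 he) A
  have hle : subsetMean p (fun A => Real.exp (-t * avoidCount Q s A)) ≤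
      subsetMean p fun A => Real.exp (-t * avoidCount Q far A) := by
    refine subsetMean_mono p fun A => ?_
    simp only [hsplit]
    refine mul_le_of_le_one_left (Real.exp_pos _).le (Real.exp_le_one_iff.2 ?_)
    exact mul_nonpos_of_nonpos_of_nonneg (neg_nonpos.2 ht) (avoidCount_nonneg Q near A)
  calc _ ≤ subsetMean p (fun A => avoids (Q i) A * Real.exp (-t * avoidCount Q near A)) *
        subsetMean p (fun A => Real.exp (-t * avoidCount Q s A)) :=
        mul_le_mul_of_nonneg_right (subsetMean_avoids_sub_le p Q near (Q i) t)
          (subsetMean_nonneg p (hexp_nonneg s))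
    _ ≤ subsetMean p (fun A => avoids (Q i) A * Real.exp (-t * avoidCount Q near A)) *
        subsetMean p (fun A => Real.exp (-t * avoidCount Q far A)) :=
        mul_le_mul_of_nonneg_left hle (subsetMean_nonneg p fun A =>
          mul_nonneg (avoids_nonneg (Q i) A) (Real.exp_pos _).le)
    _ ≤ _ := by
        simp only [hsplit]
        exact subsetMean_avoids_mul_le p (Q i) (hexp_nonneg near) (hexp_nonneg far)
          (monotone_exp_neg_mul_avoidCount Q near ht) (monotone_exp_neg_mul_avoidCount Q far ht)
          hfar

lemma hasDerivAt_subsetMean_exp (p : E → I) (f : Finset E → ℝ) (t : ℝ) :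
    HasDerivAt (fun t => subsetMean p fun A => Real.exp (-t * f A))
      (-subsetMean p fun A => f A * Real.exp (-t * f A)) t := by
  have h : HasDerivAt (fun t => subsetMean p fun A => Real.exp (-t * f A))
      (∑ A, subsetWeight p A * (Real.exp (-t * f A) * (-1 * f A))) t :=
    HasDerivAt.fun_sum fun A _ =>
      (((hasDerivAt_neg t).mul_const (f A)).exp).const_mul (subsetWeight p A)
  convert h using 1
  simp only [subsetMean, ← Finset.sum_neg_distrib]
  exact Finset.sum_congr rfl fun A _ => by ring

lemma subsetMean_exp_neg_mul_avoidCount_le (p : E → I) (Q : ι → Finset E) (s : Finset ι) {t : ℝ}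
    (ht : 0 ≤ t) :
    subsetMean p (fun A => Real.exp (-t * avoidCount Q s A)) ≤
      Real.exp (avoidCorr p Q s * t ^ 2 / 2 - avoidMean p Q s * t) := by
  set m := avoidMean p Q s
  set D := avoidCorr p Q s
  set L : ℝ → ℝ := fun t => subsetMean p fun A => Real.exp (-t * avoidCount Q s A)
  set W : ℝ → ℝ := fun t => Real.exp (m * t - D * t ^ 2 / 2)
  have hderiv (x : ℝ) : HasDerivAt (fun x => L x * W x)
      ((-subsetMean p fun A => avoidCount Q s A * Real.exp (-x * avoidCount Q s A)) * W x +
        L x * (W x * (m - D * x))) x := by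
    refine (hasDerivAt_subsetMean_exp p (avoidCount Q s) x).mul (HasDerivAt.exp ?_)
    have h := ((hasDerivAt_id x).const_mul m).sub
      ((((hasDerivAt_id x).pow 2).const_mul D).div_const 2)
    exact h.congr_deriv (by simp; ring)
  have hlower (x : ℝ) (hx : 0 ≤ x) : (m - x * D) * L x ≤
      subsetMean p fun A => avoidCount Q s A * Real.exp (-x * avoidCount Q s A) := by
    have hsum := Finset.sum_le_sum (s := s) fun i _ => sub_mul_subsetMean_exp_le p Q s i hx
    rw [← Finset.sum_mul, Finset.sum_sub_distrib, ← Finset.mul_sum] at hsum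
    refine hsum.trans_eq ?_
    rw [← subsetMean_sum]
    simp only [← Finset.sum_mul, avoidCount]
  have hanti : AntitoneOn (fun x => L x * W x) (Set.Ici 0) := by
    refine antitoneOn_of_deriv_nonpos (convex_Ici 0)
      (fun x _ => (hderiv x).continuousAt.continuousWithinAt)
      (fun x _ => (hderiv x).differentiableAt.differentiableWithinAt) fun x hx => ?_
    rw [interior_Ici, Set.mem_Ioi] at hx
    rw [(hderiv x).deriv]
    linarith [mul_le_mul_of_nonneg_right (hlower x hx.le) (Real.exp_pos (m * x - D * x ^ 2 / 2)).le]
  have hL₀ : L 0 * W 0 = 1 := by simp [L, W, subsetMean_one]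
  have hle : L t * W t ≤ 1 := (hanti Set.self_mem_Ici ht ht).trans hL₀.le
  rw [show D * t ^ 2 / 2 - m * t = -(m * t - D * t ^ 2 / 2) by ring, Real.exp_neg, ← one_div]
  exact (le_div_iff₀ (Real.exp_pos _)).2 hle

theorem janson_inequality (p : E → I) (Q : ι → Finset E) (s : Finset ι) {D : ℝ}
    (hD : 0 < D) (hmean : 0 < avoidMean p Q s) (hcorr : avoidCorr p Q s ≤ D * avoidMean p Q s ^ 2) :
    subsetMean p (fun A => if ∀ i ∈ s, ¬ Disjoint (Q i) A then 1 else 0) ≤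
      Real.exp (-(1 / (2 * D))) := by
  set m := avoidMean p Q s
  set t := 1 / (D * m)
  have ht : 0 ≤ t := by positivity
  calc subsetMean p (fun A => if ∀ i ∈ s, ¬ Disjoint (Q i) A then 1 else 0)
      ≤ subsetMean p fun A => Real.exp (-t * avoidCount Q s A) := by
        refine subsetMean_mono p fun A => ?_
        dsimp only
        split_ifs with h
        · have hcount : avoidCount Q s A = 0 := Finset.sum_eq_zero fun i hi => by
            simp [avoids, h i hi]
          simp [hcount]
        · exact (Real.exp_pos _).le
    _ ≤ Real.exp (avoidCorr p Q s * t ^ 2 / 2 - m * t) :=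
        subsetMean_exp_neg_mul_avoidCount_le p Q s ht
    _ ≤ Real.exp (D * m ^ 2 * t ^ 2 / 2 - m * t) := by gcongr
    _ = Real.exp (-(1 / (2 * D))) := by
        congr 1
        simp only [t]
        field_simp
        ring

end Janson

section Pairs

variable {V : Type*} [DecidableEq V]

/-- The unordered pairs of distinct elements of `S`. -/
def pairs (S : Finset V) : Finset (Sym2 V) := S.sym2.filter fun e => ¬ e.IsDiag

lemma mk_mem_pairs {S : Finset V} {x y : V} : s(x, y) ∈ pairs S ↔ x ∈ S ∧ y ∈ S ∧ x ≠ y := by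
  simp [pairs, and_assoc]

lemma pairs_inter (S T : Finset V) : pairs S ∩ pairs T = pairs (S ∩ T) := by
  ext e
  induction e with
  | _ x y => simp only [Finset.mem_inter, mk_mem_pairs]; tauto

lemma pairs_nonempty {S : Finset V} : (pairs S).Nonempty ↔ 2 ≤ S.card := by
  rw [← Nat.lt_iff_add_one_le, Finset.one_lt_card]
  constructor
  · rintro ⟨e, he⟩
    induction e with
    | _ x y => obtain ⟨hx, hy, hne⟩ := mk_mem_pairs.1 he; exact ⟨x, hx, y, hy, hne⟩
  · rintro ⟨x, hx, y, hy, hne⟩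
    exact ⟨s(x, y), mk_mem_pairs.2 ⟨hx, hy, hne⟩⟩

lemma isIndepSet_fromEdgeSet_iff (S : Finset V) (A : Finset (Sym2 V)) :
    (SimpleGraph.fromEdgeSet (A : Set (Sym2 V))).IsIndepSet S ↔ Disjoint (pairs S) A := by
  rw [Finset.disjoint_left]
  constructor
  · intro h e he heA
    induction e with
    | _ x y =>
      obtain ⟨hx, hy, hne⟩ := mk_mem_pairs.1 he
      exact h hx hy hne (by simp [heA, hne])
  · intro h x hx y hy hne hadj
    simp only [SimpleGraph.fromEdgeSet_adj, Finset.mem_coe] at hadj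
    exact h (mk_mem_pairs.2 ⟨hx, hy, hne⟩) hadj.1

lemma pairs_insert (v : V) (S : Finset V) :
    pairs (insert v S) = pairs S ∪ (S.erase v).image fun y => s(v, y) := by
  ext e
  induction e with
  | _ x y =>
    simp only [mk_mem_pairs, Finset.mem_insert, Finset.mem_union, Finset.mem_image,
      Finset.mem_erase, Sym2.eq_iff]
    grind

lemma sum_pairs_insert {S : Finset V} {v : V} (hv : v ∉ S) (f : Sym2 V → ℝ) :
    ∑ e ∈ pairs (insert v S), f e = ∑ e ∈ pairs S, f e + ∑ y ∈ S, f s(v, y) := by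
  rw [pairs_insert, Finset.erase_eq_of_notMem hv, Finset.sum_union, Finset.sum_image]
  · exact fun x _ y _ hxy => Sym2.congr_right.1 hxy
  · rw [Finset.disjoint_right]
    intro e he
    obtain ⟨y, -, rfl⟩ := Finset.mem_image.1 he
    exact fun h => hv (mk_mem_pairs.1 h).1

lemma sum_pairs_union {S T : Finset V} (hST : Disjoint S T) (f : Sym2 V → ℝ) :
    ∑ e ∈ pairs (S ∪ T), f e =
      ∑ e ∈ pairs S, f e + ∑ e ∈ pairs T, f e + ∑ x ∈ S, ∑ y ∈ T, f s(x, y) := by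
  induction S using Finset.induction_on with
  | empty => simp [pairs]
  | insert v S hv ih =>
    rw [Finset.disjoint_insert_left] at hST
    have hvST : v ∉ S ∪ T := by simp [hv, hST.1]
    rw [Finset.insert_union, sum_pairs_insert hvST, ih hST.2, sum_pairs_insert hv,
      Finset.sum_union hST.2, Finset.sum_insert hv]
    ring

lemma sum_pairs_eq_of_const {S : Finset V} {f : Sym2 V → ℝ} {c : ℝ}
    (h : ∀ x ∈ S, ∀ y ∈ S, x ≠ y → f s(x, y) = c) :
    ∑ e ∈ pairs S, f e = c * (S.card * (S.card - 1) / 2) := by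
  induction S using Finset.induction_on with
  | empty => simp [pairs]
  | insert v S hv ih =>
    have hstar : ∑ y ∈ S, f s(v, y) = S.card * c := by
      rw [Finset.sum_congr rfl fun y hy => h v (Finset.mem_insert_self v S) y
        (Finset.mem_insert_of_mem hy) fun hvy => hv (hvy ▸ hy), Finset.sum_const, nsmul_eq_mul]
    rw [sum_pairs_insert hv, hstar, Finset.card_insert_of_notMem hv,
      ih fun x hx y hy => h x (Finset.mem_insert_of_mem hx) y (Finset.mem_insert_of_mem hy)]
    push_cast
    ring

lemma le_sum_pairs (S : Finset V) (κ : V → ℝ) (f : Sym2 V → ℝ)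
    (h : ∀ x y, x ≠ y → (κ x + κ y) / 2 ≤ f s(x, y)) :
    ((S.card : ℝ) - 1) / 2 * ∑ x ∈ S, κ x ≤ ∑ e ∈ pairs S, f e := by
  induction S using Finset.induction_on with
  | empty => simp [pairs]
  | insert v S hv ih =>
    rw [sum_pairs_insert hv, Finset.card_insert_of_notMem hv, Finset.sum_insert hv]
    have hstar : ∑ y ∈ S, (κ v + κ y) / 2 ≤ ∑ y ∈ S, f s(v, y) :=
      Finset.sum_le_sum fun y hy => h v y fun hvy => hv (hvy ▸ hy)
    rw [← Finset.sum_div, Finset.sum_add_distrib, Finset.sum_const, nsmul_eq_mul] at hstar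
    push_cast
    linarith

end Pairs

section Law

lemma measurableSet_simpleGraph {V : Type*} [Finite V] (s : Set (SimpleGraph V)) :
    MeasurableSet s := by
  have : Finite (SimpleGraph V) := Finite.of_injective _ SimpleGraph.edgeSet_injective
  have : MeasurableSingletonClass (SimpleGraph V) := ⟨fun G => by
    convert SimpleGraph.measurable_edgeSet (measurableSet_singleton G.edgeSet) using 1
    ext H
    simp⟩
  exact s.toFinite.measurableSet

lemma measurable_setOf_coin {E : Type*} : Measurable fun coin : E → Prop => {e | coin e} :=
  MeasurableEquiv.setOfPred.measurable

lemma measurable_fromEdgeSet_coin {V : Type*} :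
    Measurable fun coin : Sym2 V → Prop => SimpleGraph.fromEdgeSet {e | coin e} :=
  SimpleGraph.measurable_fromEdgeSet.comp measurable_setOf_coin

variable {V : Type*} [DecidableEq V]

lemma binomialRandom_eq_independentEdges [Fintype V] (p : I) :
    SimpleGraph.binomialRandom V p = independentEdges V fun _ => p := by
  have hmeas (e : Sym2 V) : Measurable fun c : Prop => c ∧ e ∈ (Sym2.diagSetᶜ : Set (Sym2 V)) := by
    fun_prop
  have hcoin : (fun e : Sym2 V => unitInterval.toNNReal p •
        Measure.dirac (e ∈ (Sym2.diagSetᶜ : Set (Sym2 V))) +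
        unitInterval.toNNReal (σ p) • Measure.dirac False) =
      fun e => (bernoulliMeasure True False p).map
        fun c : Prop => c ∧ e ∈ (Sym2.diagSetᶜ : Set (Sym2 V)) := by
    ext1 e
    rw [bernoulliMeasure_def, Measure.map_add _ _ (hmeas e), Measure.map_smul, Measure.map_smul,
      Measure.map_dirac' (hmeas e), Measure.map_dirac' (hmeas e)]
    simp only [true_and, false_and]
  rw [SimpleGraph.binomialRandom_eq_map, setBernoulli_eq_map, Measure.infinitePi_eq_pi,
    Measure.map_map SimpleGraph.measurable_fromEdgeSet measurable_setOf_coin, hcoin,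
    ← Measure.pi_map_pi fun e => (hmeas e).aemeasurable,
    Measure.map_map (SimpleGraph.measurable_fromEdgeSet.comp measurable_setOf_coin)
      (by fun_prop), independentEdges]
  congr 1
  ext coin u v
  simp +contextual

lemma pi_bernoulliMeasure_singleton {E : Type*} [Fintype E] [DecidableEq E] (p : E → I)
    (A : Finset E) :
    (Measure.pi fun e => bernoulliMeasure True False (p e)) {fun e => e ∈ A} =
      ENNReal.ofReal (subsetWeight p A) := by
  have hcoe (x : I) : (unitInterval.toNNReal x : ENNReal) = ENNReal.ofReal x :=
    (ENNReal.ofReal_eq_coe_nnreal (unitInterval.nonneg x)).symm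
  rw [Measure.pi_singleton, subsetWeight, ENNReal.ofReal_prod_of_nonneg]
  · refine Finset.prod_congr rfl fun e _ => ?_
    by_cases he : e ∈ A <;> simp [he, bernoulliMeasure_def, hcoe]
  · intro e _
    split_ifs
    exacts [unitInterval.nonneg (p e), unitInterval.one_minus_nonneg (p e)]

lemma independentEdges_apply [Fintype V] (p : Sym2 V → I) (Φ : SimpleGraph V → Prop)
    [DecidablePred Φ] : independentEdges V p {G | Φ G} = ENNReal.ofReal (subsetMean p
      fun A => if Φ (SimpleGraph.fromEdgeSet (A : Set (Sym2 V))) then 1 else 0) := by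
  classical
  let edges : (Sym2 V → Prop) → Finset (Sym2 V) := fun coin => Finset.univ.filter coin
  set T : Finset (Finset (Sym2 V)) := Finset.univ.filter
    fun A => Φ (SimpleGraph.fromEdgeSet (A : Set (Sym2 V)))
  have hfiber (A : Finset (Sym2 V)) : edges ⁻¹' {A} = {fun e => e ∈ A} := by
    ext coin
    simp [edges, Finset.ext_iff, funext_iff]
  have hpreimage : ((fun coin : Sym2 V → Prop => SimpleGraph.fromEdgeSet {e | coin e}) ⁻¹'
      {G | Φ G}) = edges ⁻¹' T := by
    ext coin
    simp [edges, T]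
  rw [independentEdges,
    Measure.map_apply measurable_fromEdgeSet_coin (measurableSet_simpleGraph _),
    hpreimage, ← sum_measure_preimage_singleton T fun A _ => by
      rw [hfiber]; exact measurableSet_singleton _]
  simp only [hfiber, pi_bernoulliMeasure_singleton]
  rw [← ENNReal.ofReal_sum_of_nonneg fun A _ => subsetWeight_nonneg p A]
  simp [subsetMean, T, Finset.sum_filter]

/-- The probability that `S` is independent in the random graph with edge probabilities `p`. -/
def indepProb (p : Sym2 V → I) (S : Finset V) : ℝ := ∏ e ∈ pairs S, (1 - p e : ℝ)

lemma indepProb_nonneg (p : Sym2 V → I) (S : Finset V) : 0 ≤ indepProb p S :=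
  Finset.prod_nonneg fun e _ => unitInterval.one_minus_nonneg (p e)

lemma indepProb_pos {p : Sym2 V → I} (hp : ∀ e, (p e : ℝ) < 1) (S : Finset V) :
    0 < indepProb p S :=
  Finset.prod_pos fun e _ => sub_pos.2 (hp e)

variable [Fintype V]

lemma independentEdges_isIndepSet (p : Sym2 V → I) (S : Finset V) :
    independentEdges V p {G | G.IsIndepSet S} = ENNReal.ofReal (indepProb p S) := by
  classical
  rw [independentEdges_apply, indepProb, ← subsetMean_avoids]
  simp only [isIndepSet_fromEdgeSet_iff]
  rfl

lemma independentEdges_exists_isIndepSet_le (p : Sym2 V → I) (F : Finset (Finset V)) :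
    independentEdges V p {G | ∃ S ∈ F, G.IsIndepSet S} ≤
      ENNReal.ofReal (∑ S ∈ F, indepProb p S) := by
  have hunion : {G : SimpleGraph V | ∃ S ∈ F, G.IsIndepSet S} =
      ⋃ S ∈ F, {G | G.IsIndepSet S} := by
    ext G
    simp
  rw [hunion, ENNReal.ofReal_sum_of_nonneg fun S _ => indepProb_nonneg p S]
  refine (measure_biUnion_finset_le F _).trans_eq ?_
  simp only [independentEdges_isIndepSet]

end Law

section PairCost

/-- The cost `-log (1 - p e)` of a pair `e`: a set of vertices is independent with probability
`exp (-c)`, where `c` is the total cost of its pairs (as long as no `p e` equals one). -/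
def pairCost {V : Type*} (p : Sym2 V → I) (e : Sym2 V) : ℝ := -Real.log (1 - p e)

lemma indepProb_eq_exp {V : Type*} [DecidableEq V] {p : Sym2 V → I} (hp : ∀ e, (p e : ℝ) < 1)
    (S : Finset V) : indepProb p S = Real.exp (-∑ e ∈ pairs S, pairCost p e) := by
  simp only [indepProb, pairCost, Finset.sum_neg_distrib, neg_neg, Real.exp_sum]
  exact Finset.prod_congr rfl fun e _ => (Real.exp_log (sub_pos.2 (hp e))).symm

/-- The total cost of the pairs of a set with `u` vertices in one part and `v` in another one, if a
pair costs `c₁` or `c₂` inside the parts and `c₁₂` across. -/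
def profileCost (c₁ c₂ c₁₂ : ℝ) (u v : ℕ) : ℝ :=
  c₁ * (u * (u - 1) / 2) + c₂ * (v * (v - 1) / 2) + c₁₂ * (u * v)

variable {V : Type*}

/-- `X` and `Y` are disjoint, and a pair `e` of vertices costs `c e = c₁` inside `X`, `c e = c₂`
inside `Y` and `c e = c₁₂` between `X` and `Y`. -/
structure HasPairCosts (c : Sym2 V → ℝ) (X Y : Finset V) (c₁ c₂ c₁₂ : ℝ) : Prop where
  disjoint : Disjoint X Y
  left : ∀ x ∈ X, ∀ y ∈ X, x ≠ y → c s(x, y) = c₁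
  right : ∀ x ∈ Y, ∀ y ∈ Y, x ≠ y → c s(x, y) = c₂
  cross : ∀ x ∈ X, ∀ y ∈ Y, c s(x, y) = c₁₂

namespace HasPairCosts

variable {c : Sym2 V → ℝ} {X Y : Finset V} {c₁ c₂ c₁₂ : ℝ}

lemma mono (h : HasPairCosts c X Y c₁ c₂ c₁₂) {X' Y' : Finset V} (hX : X' ⊆ X) (hY : Y' ⊆ Y) :
    HasPairCosts c X' Y' c₁ c₂ c₁₂ where
  disjoint := h.disjoint.mono hX hY
  left x hx y hy := h.left x (hX hx) y (hX hy)
  right x hx y hy := h.right x (hY hx) y (hY hy)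
  cross x hx y hy := h.cross x (hX hx) y (hY hy)

lemma sum_pairs [DecidableEq V] (h : HasPairCosts c X Y c₁ c₂ c₁₂) {R : Finset V}
    (hR : R ⊆ X ∪ Y) :
    ∑ e ∈ pairs R, c e = profileCost c₁ c₂ c₁₂ (R ∩ X).card (R ∩ Y).card := by
  have h' := h.mono (X' := R ∩ X) (Y' := R ∩ Y) Finset.inter_subset_right
    Finset.inter_subset_right
  rw [← Finset.inter_eq_left.2 hR, Finset.inter_union_distrib_left, sum_pairs_union h'.disjoint,
    sum_pairs_eq_of_const h'.left, sum_pairs_eq_of_const h'.right,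
    Finset.sum_congr rfl fun x hx => Finset.sum_congr rfl (h'.cross x hx),
    ← Finset.inter_union_distrib_left, Finset.inter_eq_left.2 hR]
  simp only [Finset.sum_const, nsmul_eq_mul, profileCost]
  ring

end HasPairCosts

end PairCost

section Choose

lemma choose_mul_pow_le (c d u : ℕ) :
    (c + d).choose c * (u + c + d) ^ u ≤ (u + c + d).choose (u + c) * (u + c) ^ u := by
  induction u generalizing c with
  | zero => simp
  | succ u ih =>
    have habsorb := Nat.add_one_mul_choose_eq (c + d) c
    have ih := ih (c + 1)
    simp only [show c + 1 + d = c + d + 1 by ring, show u + (c + 1) = u + 1 + c by ring] at ih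
    refine Nat.le_of_mul_le_mul_left (c := c + d + 1) ?_ (by lia)
    calc (c + d + 1) * ((c + d).choose c * (u + 1 + c + d) ^ (u + 1))
        = ((c + d + 1).choose (c + 1) * (u + 1 + c + d) ^ u) * ((c + 1) * (u + 1 + c + d)) := by
          rw [pow_succ, ← mul_assoc, ← mul_assoc, habsorb]; ring
      _ ≤ ((u + 1 + c + d).choose (u + 1 + c) * (u + 1 + c) ^ u) *
          ((u + 1 + c) * (c + d + 1)) := by
          refine Nat.mul_le_mul ih ?_
          nlinarith [Nat.zero_le (u * d)]
      _ = _ := by ring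

lemma choose_sub_sub_le {M a u : ℕ} (hu : u ≤ a) (ha : a ≤ M) {q : ℝ} (hq : a ≤ q * M) :
    ((M - u).choose (a - u) : ℝ) ≤ M.choose a * q ^ u := by
  obtain ⟨c, rfl⟩ := Nat.exists_eq_add_of_le hu
  obtain ⟨d, rfl⟩ := Nat.exists_eq_add_of_le ha
  rcases Nat.eq_zero_or_pos u with rfl | hu₀
  · simp
  have hM : (0 : ℝ) < (u + c + d : ℕ) := by exact_mod_cast (by lia : 0 < u + c + d)
  have hchoose : ((c + d).choose c : ℝ) * (u + c + d : ℕ) ^ u ≤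
      (u + c + d).choose (u + c) * (u + c : ℕ) ^ u := by
    exact_mod_cast choose_mul_pow_le c d u
  rw [show u + c + d - u = c + d by lia, show u + c - u = c by lia]
  refine le_of_mul_le_mul_right (hchoose.trans ?_) (pow_pos hM u)
  rw [mul_assoc, ← mul_pow]
  gcongr

lemma card_filter_subset_powersetCard_le {V : Type*} [DecidableEq V] {A R : Finset V} {a : ℕ}
    (hR : R ⊆ A) (hRa : R.card ≤ a) (ha : a ≤ A.card) {q : ℝ} (hq : a ≤ q * A.card) :
    (((A.powersetCard a).filter (R ⊆ ·)).card : ℝ) ≤ A.card.choose a * q ^ R.card := by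
  rw [Finset.card_filter_powersetCard_subset R A a hR hRa]
  exact choose_sub_sub_le hRa ha hq

lemma sum_powerset_inv_pow_card_le {V : Type*} (S : Finset V) {r : ℝ} (hr : 0 < r)
    (hS : (S.card : ℝ) ≤ r) : ∑ R ∈ S.powerset, (1 / r) ^ R.card ≤ Real.exp 1 := by
  have hbinom := Finset.sum_pow_mul_eq_add_pow (1 / r) (1 : ℝ) S
  simp only [one_pow, mul_one] at hbinom
  calc ∑ R ∈ S.powerset, (1 / r) ^ R.card = (1 / r + 1) ^ S.card := hbinom
    _ ≤ (Real.exp (1 / r)) ^ S.card :=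
        pow_le_pow_left₀ (by positivity) (Real.add_one_le_exp _) _
    _ = Real.exp (S.card / r) := by rw [← Real.exp_nat_mul, mul_one_div]
    _ ≤ Real.exp 1 := Real.exp_le_exp.2 ((div_le_one hr).2 hS)

end Choose

section Profile

variable {V : Type*} [DecidableEq V] {A B : Finset V} {a b : ℕ}

/-- The subsets of `A ∪ B` with `a` vertices in `A` and `b` vertices in `B`. -/
def profileSets (A B : Finset V) (a b : ℕ) : Finset (Finset V) :=
  (A ∪ B).powerset.filter fun S => (S ∩ A).card = a ∧ (S ∩ B).card = b

lemma mem_profileSets {S : Finset V} :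
    S ∈ profileSets A B a b ↔ S ⊆ A ∪ B ∧ (S ∩ A).card = a ∧ (S ∩ B).card = b := by
  simp only [profileSets, Finset.mem_filter, Finset.mem_powerset]

lemma card_eq_card_inter_add_card_inter (hAB : Disjoint A B) {R : Finset V} (hR : R ⊆ A ∪ B) :
    R.card = (R ∩ A).card + (R ∩ B).card := by
  rw [← Finset.card_union_of_disjoint (hAB.mono Finset.inter_subset_right
    Finset.inter_subset_right), ← Finset.inter_union_distrib_left, Finset.inter_eq_left.2 hR]

lemma card_filter_subset_profileSets (hAB : Disjoint A B) {R : Finset V} (hR : R ⊆ A ∪ B) :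
    ((profileSets A B a b).filter (R ⊆ ·)).card =
      ((A.powersetCard a).filter (R ∩ A ⊆ ·)).card *
        ((B.powersetCard b).filter (R ∩ B ⊆ ·)).card := by
  have hinter {S T : Finset V} (hS : S ⊆ A) (hT : T ⊆ B) :
      (S ∪ T) ∩ A = S ∧ (S ∪ T) ∩ B = T := by
    rw [Finset.union_inter_distrib_right, Finset.union_inter_distrib_right,
      Finset.disjoint_iff_inter_eq_empty.1 (hAB.symm.mono_left hT),
      Finset.disjoint_iff_inter_eq_empty.1 (hAB.mono_left hS), Finset.inter_eq_left.2 hS,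
      Finset.inter_eq_left.2 hT, Finset.union_empty, Finset.empty_union]
    exact ⟨rfl, rfl⟩
  rw [← Finset.card_product]
  refine Finset.card_nbij' (fun S => (S ∩ A, S ∩ B)) (fun S => S.1 ∪ S.2) ?_ ?_ ?_ ?_
  · intro S hS
    simp only [Finset.coe_filter, Set.mem_ofPred_eq, mem_profileSets] at hS
    simp only [Finset.coe_product, Set.mem_prod, Finset.coe_filter, Set.mem_ofPred_eq,
      Finset.mem_powersetCard]
    exact ⟨⟨⟨Finset.inter_subset_right, hS.1.2.1⟩, Finset.inter_subset_inter_right hS.2⟩,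
      ⟨Finset.inter_subset_right, hS.1.2.2⟩, Finset.inter_subset_inter_right hS.2⟩
  · rintro ⟨S, T⟩ hST
    simp only [Finset.coe_product, Set.mem_prod, Finset.coe_filter, Set.mem_ofPred_eq,
      Finset.mem_powersetCard] at hST
    obtain ⟨⟨⟨hS, rfl⟩, hRS⟩, ⟨hT, rfl⟩, hRT⟩ := hST
    simp only [Finset.coe_filter, Set.mem_ofPred_eq, mem_profileSets, hinter hS hT, and_self,
      and_true]
    refine ⟨Finset.union_subset_union hS hT, ?_⟩
    rw [← Finset.inter_eq_left.2 hR, Finset.inter_union_distrib_left]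
    exact Finset.union_subset_union hRS hRT
  · intro S hS
    simp only [Finset.coe_filter, Set.mem_ofPred_eq, mem_profileSets] at hS
    change S ∩ A ∪ S ∩ B = S
    rw [← Finset.inter_union_distrib_left, Finset.inter_eq_left.2 hS.1.1]
  · rintro ⟨S, T⟩ hST
    simp only [Finset.coe_product, Set.mem_prod, Finset.coe_filter, Set.mem_ofPred_eq,
      Finset.mem_powersetCard] at hST
    exact Prod.ext (hinter hST.1.1.1 hST.2.1.1).1 (hinter hST.1.1.1 hST.2.1.1).2

lemma card_profileSets (hAB : Disjoint A B) :
    (profileSets A B a b).card = A.card.choose a * B.card.choose b := by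
  simpa using card_filter_subset_profileSets (a := a) (b := b) hAB (Finset.empty_subset (A ∪ B))

lemma profileSets_nonempty (hAB : Disjoint A B) (ha : a ≤ A.card) (hb : b ≤ B.card) :
    (profileSets A B a b).Nonempty := by
  rw [← Finset.card_pos, card_profileSets hAB]
  exact Nat.mul_pos (Nat.choose_pos ha) (Nat.choose_pos hb)

lemma card_filter_subset_profileSets_le (hAB : Disjoint A B) (ha : a ≤ A.card) (hb : b ≤ B.card)
    {q : ℝ} (hq : 0 ≤ q) (haq : a ≤ q * A.card) (hbq : b ≤ q * B.card) {R : Finset V}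
    (hR : R ⊆ A ∪ B) (hRa : (R ∩ A).card ≤ a) (hRb : (R ∩ B).card ≤ b) :
    (((profileSets A B a b).filter (R ⊆ ·)).card : ℝ) ≤
      (profileSets A B a b).card * q ^ R.card := by
  rw [card_filter_subset_profileSets hAB hR, card_profileSets hAB,
    card_eq_card_inter_add_card_inter hAB hR, pow_add]
  push_cast
  calc _ ≤ (A.card.choose a * q ^ (R ∩ A).card) * (B.card.choose b * q ^ (R ∩ B).card) :=
        mul_le_mul (card_filter_subset_powersetCard_le Finset.inter_subset_right hRa ha haq)
          (card_filter_subset_powersetCard_le Finset.inter_subset_right hRb hb hbq)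
          (by positivity) (by positivity)
    _ = _ := by ring

end Profile

section FirstMoment

variable {V : Type*} [DecidableEq V] {p : Sym2 V → I} {κ : V → ℝ} {K ε : ℝ} {n : ℕ}

lemma indepProb_le_of_heavy (hp : ∀ e, (p e : ℝ) < 1) (hK : 0 < K) (hκ : ∀ x, κ x ≤ K)
    (hcost : ∀ x y, x ≠ y → (κ x + κ y) / 2 ≤ pairCost p s(x, y)) (hn : 0 < n) (hε : 0 < ε)
    (hlarge : 2 ≤ ε / 2 * ((2 + ε) * Real.log n / K - 1)) {S : Finset V}
    (hS : (2 + ε) * Real.log n ≤ ∑ x ∈ S, κ x) :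
    indepProb p S ≤ (1 / n : ℝ) ^ (S.card + 1) := by
  have hlog : 0 ≤ Real.log n := Real.log_natCast_nonneg n
  have hcard : (2 + ε) * Real.log n / K ≤ S.card := by
    rw [div_le_iff₀ hK, ← nsmul_eq_mul]
    exact hS.trans (Finset.sum_le_card_nsmul S κ K fun x _ => hκ x)
  have hlarge' : 2 ≤ ε / 2 * ((S.card : ℝ) - 1) := hlarge.trans (by gcongr)
  have hcard₁ : 0 ≤ ((S.card : ℝ) - 1) / 2 := by
    by_contra hneg
    nlinarith
  have htotal : ((S.card : ℝ) + 1) * Real.log n ≤ ∑ e ∈ pairs S, pairCost p e := by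
    linarith [le_sum_pairs S κ (pairCost p) hcost, mul_le_mul_of_nonneg_left hS hcard₁,
      mul_le_mul_of_nonneg_right hlarge' hlog]
  calc indepProb p S = Real.exp (-∑ e ∈ pairs S, pairCost p e) := indepProb_eq_exp hp S
    _ ≤ Real.exp (-((S.card + 1 : ℕ) * Real.log n)) := by
        push_cast
        exact Real.exp_le_exp.2 (neg_le_neg htotal)
    _ = (1 / n : ℝ) ^ (S.card + 1) := by
        rw [Real.exp_neg, Real.exp_nat_mul, Real.exp_log (by exact_mod_cast hn), one_div, inv_pow]

lemma independentEdges_exists_heavy_isIndepSet_le [Fintype V] (hp : ∀ e, (p e : ℝ) < 1)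
    (hK : 0 < K) (hκ : ∀ x, κ x ≤ K)
    (hcost : ∀ x y, x ≠ y → (κ x + κ y) / 2 ≤ pairCost p s(x, y)) (hn : 0 < n)
    (hV : Fintype.card V ≤ n) (hε : 0 < ε)
    (hlarge : 2 ≤ ε / 2 * ((2 + ε) * Real.log n / K - 1)) :
    independentEdges V p {G | ∃ S : Finset V, (2 + ε) * Real.log n ≤ ∑ x ∈ S, κ x ∧
      G.IsIndepSet S} ≤ ENNReal.ofReal (Real.exp 1 / n) := by
  set F : Finset (Finset V) := Finset.univ.filter fun S => (2 + ε) * Real.log n ≤ ∑ x ∈ S, κ x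
  have hF (G : SimpleGraph V) : (∃ S : Finset V, (2 + ε) * Real.log n ≤ ∑ x ∈ S, κ x ∧
      G.IsIndepSet S) ↔ ∃ S ∈ F, G.IsIndepSet S := by
    simp [F]
  simp only [hF]
  refine (independentEdges_exists_isIndepSet_le p F).trans (ENNReal.ofReal_le_ofReal ?_)
  calc ∑ S ∈ F, indepProb p S
      ≤ ∑ S ∈ F, (1 / n : ℝ) ^ (S.card + 1) := Finset.sum_le_sum fun S hS =>
        indepProb_le_of_heavy hp hK hκ hcost hn hε hlarge (Finset.mem_filter.1 hS).2
    _ ≤ ∑ S ∈ (Finset.univ : Finset V).powerset, (1 / n : ℝ) ^ (S.card + 1) :=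
        Finset.sum_le_sum_of_subset_of_nonneg (by simp) fun S _ _ => by positivity
    _ = (∑ S ∈ (Finset.univ : Finset V).powerset, (1 / n : ℝ) ^ S.card) / n := by
        simp only [pow_succ, mul_one_div, Finset.sum_div]
    _ ≤ Real.exp 1 / n := by
        gcongr
        exact sum_powerset_inv_pow_card_le _ (by exact_mod_cast hn) (by exact_mod_cast hV)

end FirstMoment

section SecondMoment

variable {V : Type*} [Fintype V] [DecidableEq V] {p : Sym2 V → I} {F : Finset (Finset V)} {r δ : ℝ}

/-- The family `F` of vertex sets is so spread out that Janson's inequality yields an independent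
one: each of its members has at most `r` vertices, and the expected number of independent members
that contain a given subset `R` of a member is, conditionally on `R` being independent, at most
`δ / r ^ |R|` times the expected number of all independent members. -/
structure IsSpread (p : Sym2 V → I) (F : Finset (Finset V)) (r δ : ℝ) : Prop where
  card_le : ∀ S ∈ F, (S.card : ℝ) ≤ r
  sum_le : ∀ S ∈ F, ∀ R ⊆ S, 2 ≤ R.card →
    ∑ T ∈ F with R ⊆ T, indepProb p T ≤
      δ * (1 / r) ^ R.card * indepProb p R * ∑ T ∈ F, indepProb p T

lemma subsetMean_avoids_pairs_union_mul (p : Sym2 V → I) (S T : Finset V) :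
    subsetMean p (avoids (pairs S ∪ pairs T)) * indepProb p (S ∩ T) =
      indepProb p S * indepProb p T := by
  rw [subsetMean_avoids, indepProb, ← pairs_inter, Finset.prod_union_inter, indepProb, indepProb]

lemma sum_subsetMean_avoids_pairs_union_le_sum_powerset (hp : ∀ e, (p e : ℝ) < 1)
    (F : Finset (Finset V)) (S : Finset V) :
    ∑ T ∈ F with ¬ Disjoint (pairs S) (pairs T), subsetMean p (avoids (pairs S ∪ pairs T)) ≤
      ∑ R ∈ S.powerset with 2 ≤ R.card,
        indepProb p S / indepProb p R * ∑ T ∈ F with R ⊆ T, indepProb p T := by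
  have hpos := indepProb_pos hp
  have hterm (R T : Finset V) : 0 ≤ indepProb p S * indepProb p T / indepProb p R :=
    div_nonneg (mul_nonneg (hpos S).le (hpos T).le) (hpos R).le
  set W := S.powerset.filter fun R => 2 ≤ R.card
  calc ∑ T ∈ F with ¬ Disjoint (pairs S) (pairs T), subsetMean p (avoids (pairs S ∪ pairs T))
      = ∑ T ∈ F with ¬ Disjoint (pairs S) (pairs T),
          indepProb p S * indepProb p T / indepProb p (S ∩ T) :=
        Finset.sum_congr rfl fun T _ =>
          (eq_div_iff (hpos _).ne').2 (subsetMean_avoids_pairs_union_mul p S T)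
    _ ≤ ∑ T ∈ F with ¬ Disjoint (pairs S) (pairs T),
          ∑ R ∈ W with R ⊆ T, indepProb p S * indepProb p T / indepProb p R := by
        refine Finset.sum_le_sum fun T hT => Finset.single_le_sum
          (f := fun R => indepProb p S * indepProb p T / indepProb p R) (fun R _ => hterm R T) ?_
        have hmeet := (Finset.mem_filter.1 hT).2
        rw [Finset.not_disjoint_iff_nonempty_inter, pairs_inter, pairs_nonempty] at hmeet
        simp [W, hmeet]
    _ ≤ ∑ T ∈ F, ∑ R ∈ W with R ⊆ T, indepProb p S * indepProb p T / indepProb p R :=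
        Finset.sum_le_sum_of_subset_of_nonneg (Finset.filter_subset _ _) fun T _ _ =>
          Finset.sum_nonneg fun R _ => hterm R T
    _ = ∑ R ∈ W, indepProb p S / indepProb p R * ∑ T ∈ F with R ⊆ T, indepProb p T := by
        simp only [Finset.sum_filter, Finset.mul_sum, mul_ite, mul_zero, div_mul_eq_mul_div]
        exact Finset.sum_comm

lemma IsSpread.sum_subsetMean_avoids_pairs_union_le (hF : IsSpread p F r δ)
    (hp : ∀ e, (p e : ℝ) < 1) (hr : 0 < r) (hδ : 0 ≤ δ) {S : Finset V} (hS : S ∈ F) :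
    ∑ T ∈ F with ¬ Disjoint (pairs S) (pairs T), subsetMean p (avoids (pairs S ∪ pairs T)) ≤
      δ * Real.exp 1 * indepProb p S * ∑ T ∈ F, indepProb p T := by
  have hpos := indepProb_pos hp
  have hM : 0 ≤ ∑ T ∈ F, indepProb p T := Finset.sum_nonneg fun T _ => (hpos T).le
  calc ∑ T ∈ F with ¬ Disjoint (pairs S) (pairs T), subsetMean p (avoids (pairs S ∪ pairs T))
      ≤ ∑ R ∈ S.powerset with 2 ≤ R.card,
          indepProb p S / indepProb p R * ∑ T ∈ F with R ⊆ T, indepProb p T :=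
        sum_subsetMean_avoids_pairs_union_le_sum_powerset hp F S
    _ ≤ ∑ R ∈ S.powerset with 2 ≤ R.card,
          δ * indepProb p S * (∑ T ∈ F, indepProb p T) * (1 / r) ^ R.card := by
        refine Finset.sum_le_sum fun R hR => ?_
        obtain ⟨hRS, hRcard⟩ := Finset.mem_filter.1 hR
        rw [div_mul_eq_mul_div, div_le_iff₀ (hpos R)]
        refine (mul_le_mul_of_nonneg_left (hF.sum_le S hS R (Finset.mem_powerset.1 hRS) hRcard)
          (hpos S).le).trans_eq (by ring)
    _ ≤ ∑ R ∈ S.powerset, δ * indepProb p S * (∑ T ∈ F, indepProb p T) * (1 / r) ^ R.card :=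
        Finset.sum_le_sum_of_subset_of_nonneg (Finset.filter_subset _ _) fun R _ _ =>
          mul_nonneg (mul_nonneg (mul_nonneg hδ (hpos S).le) hM) (by positivity)
    _ ≤ δ * indepProb p S * (∑ T ∈ F, indepProb p T) * Real.exp 1 := by
        rw [← Finset.mul_sum]
        exact mul_le_mul_of_nonneg_left (sum_powerset_inv_pow_card_le S hr (hF.card_le S hS))
          (mul_nonneg (mul_nonneg hδ (hpos S).le) hM)
    _ = _ := by ring

lemma avoidMean_pairs (p : Sym2 V → I) (F : Finset (Finset V)) :
    avoidMean p pairs F = ∑ S ∈ F, indepProb p S :=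
  Finset.sum_congr rfl fun S _ => subsetMean_avoids p (pairs S)

lemma IsSpread.avoidCorr_le (hF : IsSpread p F r δ) (hp : ∀ e, (p e : ℝ) < 1) (hr : 0 < r)
    (hδ : 0 ≤ δ) : avoidCorr p pairs F ≤ δ * Real.exp 1 * avoidMean p pairs F ^ 2 := by
  refine (Finset.sum_le_sum fun S hS =>
    hF.sum_subsetMean_avoids_pairs_union_le hp hr hδ hS).trans_eq ?_
  rw [← Finset.sum_mul, ← Finset.mul_sum, ← avoidMean_pairs]
  ring

lemma IsSpread.independentEdges_forall_not_isIndepSet_le (hF : IsSpread p F r δ)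
    (hp : ∀ e, (p e : ℝ) < 1) (hr : 0 < r) (hδ : 0 < δ) (hne : F.Nonempty) :
    independentEdges V p {G | ∀ S ∈ F, ¬ G.IsIndepSet S} ≤
      ENNReal.ofReal (Real.exp (-(1 / (6 * δ)))) := by
  classical
  have hmean : 0 < avoidMean p pairs F := by
    rw [avoidMean_pairs]
    exact Finset.sum_pos (fun S _ => indepProb_pos hp S) hne
  have hcorr : avoidCorr p pairs F ≤ 3 * δ * avoidMean p pairs F ^ 2 := by
    refine (hF.avoidCorr_le hp hr hδ.le).trans ?_
    rw [mul_comm 3 δ]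
    gcongr
    exact Real.exp_one_lt_three.le
  rw [independentEdges_apply, show 6 * δ = 2 * (3 * δ) by ring]
  convert ENNReal.ofReal_le_ofReal (janson_inequality p pairs F (by positivity) hmean hcorr)
    using 6 with A
  simp only [isIndepSet_fromEdgeSet_iff]

end SecondMoment

section Profile

variable {V : Type*} [DecidableEq V] {p : Sym2 V → I} {A B X Y : Finset V}
  {c₁ c₂ c₁₂ r q m δ : ℝ} {a b : ℕ}

lemma indepProb_of_mem_profileSets (hp : ∀ e, (p e : ℝ) < 1)
    (hc : HasPairCosts (pairCost p) A B c₁ c₂ c₁₂) {S : Finset V}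
    (hS : S ∈ profileSets A B a b) : indepProb p S = Real.exp (-profileCost c₁ c₂ c₁₂ a b) := by
  obtain ⟨hSAB, hSA, hSB⟩ := mem_profileSets.1 hS
  rw [indepProb_eq_exp hp, hc.sum_pairs hSAB, hSA, hSB]

lemma isSpread_profileSets (hp : ∀ e, (p e : ℝ) < 1)
    (hc : HasPairCosts (pairCost p) A B c₁ c₂ c₁₂) (ha : a ≤ A.card) (hb : b ≤ B.card)
    (hr : 0 < r) (hab : (a + b : ℝ) ≤ r) (hq : 0 ≤ q) (haq : a ≤ q * A.card)
    (hbq : b ≤ q * B.card)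
    (hδ : ∀ u v : ℕ, u ≤ a → v ≤ b → 2 ≤ u + v →
      (r * q) ^ (u + v) * Real.exp (profileCost c₁ c₂ c₁₂ u v) ≤ δ) :
    IsSpread p (profileSets A B a b) r δ where
  card_le S hS := by
    obtain ⟨hSAB, hSA, hSB⟩ := mem_profileSets.1 hS
    rw [card_eq_card_inter_add_card_inter hc.disjoint hSAB, hSA, hSB]
    exact_mod_cast hab
  sum_le S hS R hRS hR := by
    obtain ⟨hSAB, hSA, hSB⟩ := mem_profileSets.1 hS
    have hRAB : R ⊆ A ∪ B := hRS.trans hSAB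
    have hRA : (R ∩ A).card ≤ a := hSA ▸ Finset.card_le_card (Finset.inter_subset_inter_right hRS)
    have hRB : (R ∩ B).card ≤ b := hSB ▸ Finset.card_le_card (Finset.inter_subset_inter_right hRS)
    have hcard := card_eq_card_inter_add_card_inter hc.disjoint hRAB
    have hδR := hδ _ _ hRA hRB (hcard ▸ hR)
    rw [← hcard, mul_pow] at hδR
    have hqR : q ^ R.card ≤
        δ * (1 / r) ^ R.card * Real.exp (-profileCost c₁ c₂ c₁₂ (R ∩ A).card (R ∩ B).card) := by
      rw [Real.exp_neg, ← div_eq_mul_inv, le_div_iff₀ (Real.exp_pos _), one_div, inv_pow,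
        ← div_eq_mul_inv, le_div_iff₀ (by positivity)]
      linarith
    rw [Finset.sum_congr rfl fun T hT =>
        indepProb_of_mem_profileSets hp hc (Finset.mem_filter.1 hT).1,
      Finset.sum_congr rfl fun T hT => indepProb_of_mem_profileSets hp hc hT,
      indepProb_eq_exp hp R, hc.sum_pairs hRAB, Finset.sum_const, Finset.sum_const, nsmul_eq_mul,
      nsmul_eq_mul, ← mul_assoc]
    refine mul_le_mul_of_nonneg_right ?_ (Real.exp_pos _).le
    refine (card_filter_subset_profileSets_le hc.disjoint ha hb hq haq hbq hRAB hRA hRB).trans ?_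
    rw [mul_comm]
    gcongr

/-- All subsets `A` of `X` and `B` of `Y` with at least `m` vertices contain an independent set with
`a` vertices in `A` and `b` in `B`. The size of `B` does not matter if `b = 0`, so that the case
`Y = ∅`, `b = 0` is about independent sets inside `X`. -/
def HasProfileSets {V : Type*} [DecidableEq V] (G : SimpleGraph V) (X Y : Finset V) (m : ℝ)
    (a b : ℕ) : Prop :=
  ∀ A ⊆ X, ∀ B ⊆ Y, m ≤ A.card → (0 < b → m ≤ B.card) → ∃ S ∈ profileSets A B a b, G.IsIndepSet S

lemma independentEdges_forall_mem_profileSets_not_isIndepSet_le [Fintype V]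
    (hp : ∀ e, (p e : ℝ) < 1) (hc : HasPairCosts (pairCost p) A B c₁ c₂ c₁₂) (hm : 0 < m)
    (hA : m ≤ A.card) (hB : 0 < b → m ≤ B.card) (hr : 0 < r) (hab : (a + b : ℝ) ≤ r)
    (hrm : r ≤ m) (hδ₀ : 0 < δ)
    (hδ : ∀ u v : ℕ, u ≤ a → v ≤ b → 2 ≤ u + v →
      (r * (r / m)) ^ (u + v) * Real.exp (profileCost c₁ c₂ c₁₂ u v) ≤ δ) :
    independentEdges V p {G | ∀ S ∈ profileSets A B a b, ¬ G.IsIndepSet S} ≤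
      ENNReal.ofReal (Real.exp (-(1 / (6 * δ)))) := by
  have hsize {k : ℕ} {C : Finset V} (hk : k ≤ r) (hC : 0 < k → m ≤ C.card) :
      k ≤ C.card ∧ k ≤ r / m * C.card := by
    rcases Nat.eq_zero_or_pos k with rfl | hk₀
    · exact ⟨Nat.zero_le _, by rw [Nat.cast_zero]; positivity⟩
    · refine ⟨by exact_mod_cast (hk.trans hrm).trans (hC hk₀), hk.trans ?_⟩
      rw [div_mul_eq_mul_div, le_div_iff₀ hm]
      exact mul_le_mul_of_nonneg_left (hC hk₀) hr.le
  obtain ⟨haA, haq⟩ := hsize (k := a) (by linarith [Nat.cast_nonneg (α := ℝ) b]) fun _ => hA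
  obtain ⟨hbB, hbq⟩ := hsize (k := b) (by linarith [Nat.cast_nonneg (α := ℝ) a]) hB
  exact (isSpread_profileSets hp hc haA hbB hr hab (by positivity) haq hbq
    hδ).independentEdges_forall_not_isIndepSet_le hp hr hδ₀
    (profileSets_nonempty hc.disjoint haA hbB)

lemma independentEdges_not_hasProfileSets_le [Fintype V] (hp : ∀ e, (p e : ℝ) < 1)
    (hc : HasPairCosts (pairCost p) X Y c₁ c₂ c₁₂) (hm : 0 < m) (hr : 0 < r)
    (hab : (a + b : ℝ) ≤ r) (hrm : r ≤ m) (hδ₀ : 0 < δ)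
    (hδ : ∀ u v : ℕ, u ≤ a → v ≤ b → 2 ≤ u + v →
      (r * (r / m)) ^ (u + v) * Real.exp (profileCost c₁ c₂ c₁₂ u v) ≤ δ) :
    independentEdges V p {G | ¬ HasProfileSets G X Y m a b} ≤
      ENNReal.ofReal (2 ^ Fintype.card V * Real.exp (-(1 / (6 * δ)))) := by
  set D : Finset (Finset V × Finset V) := (X.powerset ×ˢ Y.powerset).filter
    fun AB => m ≤ AB.1.card ∧ (0 < b → m ≤ AB.2.card)
  have hD : D.card ≤ 2 ^ Fintype.card V := by
    calc D.card ≤ (X.powerset ×ˢ Y.powerset).card := Finset.card_filter_le _ _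
      _ = 2 ^ (X ∪ Y).card := by
          rw [Finset.card_product, Finset.card_powerset, Finset.card_powerset, ← pow_add,
            Finset.card_union_of_disjoint hc.disjoint]
      _ ≤ 2 ^ Fintype.card V := Nat.pow_le_pow_right two_pos (Finset.card_le_univ _)
  have hfail : {G : SimpleGraph V | ¬ HasProfileSets G X Y m a b} =
      ⋃ AB ∈ D, {G | ∀ S ∈ profileSets AB.1 AB.2 a b, ¬ G.IsIndepSet S} := by
    ext G
    simp only [HasProfileSets, D, Set.mem_ofPred_eq, Set.mem_iUnion, Finset.mem_filter,
      Finset.mem_product, Finset.mem_powerset, Prod.exists]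
    grind
  rw [hfail]
  refine (measure_biUnion_finset_le D _).trans ((Finset.sum_le_card_nsmul D _
    (ENNReal.ofReal (Real.exp (-(1 / (6 * δ))))) fun AB hAB => ?_).trans ?_)
  · simp only [D, Finset.mem_filter, Finset.mem_product, Finset.mem_powerset] at hAB
    obtain ⟨⟨hA, hB⟩, hAm, hBm⟩ := hAB
    exact independentEdges_forall_mem_profileSets_not_isIndepSet_le hp (hc.mono hA hB) hm hAm hBm
      hr hab hrm hδ₀ hδ
  · rw [nsmul_eq_mul, ← ENNReal.ofReal_natCast, ← ENNReal.ofReal_mul (Nat.cast_nonneg _)]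
    gcongr
    exact_mod_cast hD

end Profile

section Subcritical

variable {c₁ c₂ c₁₂ : ℝ}

/-- The sets with `u ≤ β₁ L` vertices in one part and `v ≤ β₂ L` in another one, `2 ≤ u + v`, have a
total pair cost that is smaller than `(u + v) L`, with enough room for Janson's inequality. Here
`L = log n` and the pair costs are as in `profileCost`. -/
def IsSubcritical (c₁ c₂ c₁₂ β₁ β₂ : ℝ) : Prop :=
  ∃ τ > 0, ∀ᶠ L : ℝ in atTop, ∀ u v : ℕ, u ≤ β₁ * L → v ≤ β₂ * L → 2 ≤ u + v →
    profileCost c₁ c₂ c₁₂ u v + 3 / 2 * L ≤ (u + v) * ((1 - τ) * L)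

lemma profileCost_eq (c₁ c₂ c₁₂ : ℝ) (u v : ℕ) : profileCost c₁ c₂ c₁₂ u v =
    ((u + v : ℝ) - 1) / 2 * (c₁ * u + c₂ * v) - ((c₁ + c₂) / 2 - c₁₂) * (u * v) := by
  unfold profileCost
  ring

-- If `s` is large, then the term `ε / 2 * (s * L)` that `hl` saves pays for everything else;
-- otherwise `l` is bounded and hence at most `L / 8`.
lemma half_mul_weight_add_le_of_light {L K ε s l : ℝ} (hε : 0 < ε) (hε' : ε ≤ 1 / 2) (hs : 2 ≤ s)
    (hl₀ : 0 ≤ l) (hlK : l ≤ K * s) (hl : l ≤ (2 - ε) * L) (hK : 0 ≤ K) (hL : 32 * K / ε ≤ L) :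
    (s - 1) / 2 * l + 3 / 2 * L ≤ s * ((1 - ε / 8) * L) := by
  have hL₀ : 0 ≤ L := le_trans (by positivity) hL
  rw [div_le_iff₀ hε] at hL
  by_cases hsε : 4 ≤ s * ε
  · have hsl : s * l ≤ s * ((2 - ε) * L) := by gcongr
    have hsaving : 4 * L ≤ s * ε * L := by gcongr
    linarith
  · have hKs : K * s * ε ≤ K * 4 := by
      rw [mul_assoc]
      exact mul_le_mul_of_nonneg_left (by linarith) hK
    have hlε : l * ε ≤ L / 8 * ε := by linarith [mul_le_mul_of_nonneg_right hlK hε.le]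
    have hsl : s * l ≤ s * (L / 8) := by
      gcongr
      exact le_of_mul_le_mul_right hlε hε
    have hsL : 2 * L ≤ s * L := by gcongr
    have hεsL : ε * (s * L) ≤ 1 / 2 * (s * L) := by gcongr
    linarith

-- Both parts of a heavy set have a weight of order `L`, so that the cross pairs save a cost of
-- order `d * L ^ 2`, more than the excess of order `η * L ^ 2` due to the weight above `2 * L`.
lemma half_mul_weight_sub_add_le_of_heavy {L d η u v : ℝ} (hc₁ : 0 < c₁) (hc₂ : 0 < c₂)
    (hd : 0 < d) (hη : 0 < η) (hη' : η ≤ 1 / 4) (hηd : η * (c₂ + 2 * c₁) ≤ d / 8) (hu₀ : 0 ≤ u)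
    (hv₀ : 0 ≤ v) (hu : c₁ * u ≤ L) (hv : c₂ * v ≤ (1 + η) * L)
    (hheavy : (2 - η) * L ≤ c₁ * u + c₂ * v) (hL : 12 * (c₁ * c₂) / d ≤ L) :
    (u + v - 1) / 2 * (c₁ * u + c₂ * v) - d * (u * v) + 3 / 2 * L ≤
      (u + v) * ((1 - η / 8) * L) := by
  have hL₀ : 0 ≤ L := le_trans (by positivity) hL
  rw [div_le_iff₀ hd] at hL
  have hηL : η * L ≤ 1 / 4 * L := by gcongr
  have hcross : L / 2 * (L / 2) ≤ c₁ * u * (c₂ * v) := by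
    gcongr <;> linarith
  have hsize : (c₁ * c₂) * (u + v) ≤ (c₂ + 2 * c₁) * L := by
    have hu' : c₂ * (c₁ * u) ≤ c₂ * L := by gcongr
    have hv' : c₁ * (c₂ * v) ≤ c₁ * (2 * L) :=
      mul_le_mul_of_nonneg_left (by linarith) hc₁.le
    linarith
  have hweight : (u + v - 1) / 2 * (c₁ * u + c₂ * v) ≤ (u + v) * ((1 + η / 2) * L) := by
    have hweight' : (u + v) * (c₁ * u + c₂ * v) ≤ (u + v) * ((2 + η) * L) := by
      gcongr
      linarith
    have : 0 ≤ c₁ * u + c₂ * v := by positivity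
    linarith
  suffices hsaving : (c₁ * c₂) * ((u + v) * (η * L) + 3 / 2 * L) ≤ (c₁ * c₂) * (d * (u * v)) by
    have := le_of_mul_le_mul_left hsaving (by positivity)
    have : 0 ≤ (u + v) * (η * L) := by positivity
    linarith
  have hsizeη : (c₁ * c₂) * (u + v) * (η * L) ≤ (c₂ + 2 * c₁) * L * (η * L) := by gcongr
  have hηL2 : η * (c₂ + 2 * c₁) * L ^ 2 ≤ d / 8 * L ^ 2 := by gcongr
  have hL2 : 12 * (c₁ * c₂) * L ≤ L * d * L := by gcongr
  linarith [mul_le_mul_of_nonneg_left hcross hd.le]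

lemma isSubcritical_solo {c ε : ℝ} (hc : 0 < c) (hε : 0 < ε) (hε' : ε ≤ 1 / 2) :
    IsSubcritical c 0 0 ((2 - ε) / c) 0 := by
  refine ⟨ε / 8, by positivity, ?_⟩
  filter_upwards [eventually_ge_atTop (32 * c / ε)] with L hL u v hu hv huv
  obtain rfl : v = 0 := by
    rw [zero_mul] at hv
    exact_mod_cast le_antisymm hv (Nat.cast_nonneg v)
  rw [div_mul_eq_mul_div, le_div_iff₀ hc] at hu
  have hbound := half_mul_weight_add_le_of_light (s := u) (l := c * u) hε hε'
    (by exact_mod_cast huv) (by positivity) le_rfl (by linarith) hc.le hL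
  rw [profileCost_eq]
  simpa using hbound

lemma exists_isSubcritical_mixed (hc₁ : 0 < c₁) (hc₂ : 0 < c₂) (hc₁₂ : c₁₂ < (c₁ + c₂) / 2) :
    ∃ η > 0, IsSubcritical c₁ c₂ c₁₂ (1 / c₁) ((1 + η) / c₂) := by
  set d := (c₁ + c₂) / 2 - c₁₂ with hd
  have hd₀ : 0 < d := by linarith
  set η := min (1 / 4) (d / 8 / (c₂ + 2 * c₁))
  have hη₀ : 0 < η := by positivity
  have hη : η ≤ 1 / 4 := min_le_left _ _
  have hηd : η * (c₂ + 2 * c₁) ≤ d / 8 := (le_div_iff₀ (by positivity)).1 (min_le_right _ _)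
  refine ⟨η, hη₀, η / 8, by positivity, ?_⟩
  filter_upwards [eventually_ge_atTop (32 * (c₁ + c₂) / η),
    eventually_ge_atTop (12 * (c₁ * c₂) / d)] with L hlight hheavy u v hu hv huv
  rw [div_mul_eq_mul_div, le_div_iff₀ (by assumption)] at hu hv
  rw [profileCost_eq, ← hd]
  rcases le_total (c₁ * u + c₂ * v) ((2 - η) * L) with hl | hl
  · have hweight : c₁ * u + c₂ * v ≤ (c₁ + c₂) * (u + v) := by
      have : 0 ≤ c₁ * v + c₂ * u := by positivity
      linarith
    have hbound := half_mul_weight_add_le_of_light hη₀ (by linarith) (by exact_mod_cast huv)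
      (by positivity) hweight hl (by positivity) hlight
    have : 0 ≤ d * (u * v) := by positivity
    linarith
  · exact half_mul_weight_sub_add_le_of_heavy hc₁ hc₂ hd₀ hη₀ hη hηd (by positivity)
      (by positivity) (by linarith) (by linarith) hl hheavy

end Subcritical

section Bulk

lemma tendsto_log_natCast : Tendsto (fun n : ℕ => Real.log n) atTop atTop :=
  Real.tendsto_log_atTop.comp tendsto_natCast_atTop_atTop

lemma eventually_mul_pow_le_exp (C : ℝ) {τ : ℝ} (hτ : 0 < τ) (k : ℕ) :
    ∀ᶠ L : ℝ in atTop, C * L ^ k ≤ Real.exp (τ * L) := by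
  have h := (tendsto_rpow_mul_exp_neg_mul_atTop_nhds_zero (k : ℝ) τ hτ).const_mul C
  rw [mul_zero] at h
  filter_upwards [h.eventually (gt_mem_nhds zero_lt_one)] with L hL
  rw [neg_mul, Real.exp_neg, Real.rpow_natCast, ← mul_assoc, ← div_eq_mul_inv,
    div_lt_one (Real.exp_pos _)] at hL
  exact hL.le

/-- The size `n / (log n)²` from which on vertex sets behave typically, simultaneously and with high
probability; sets of fewer vertices are negligible when colouring. -/
def bulkSize (n : ℕ) : ℝ := n / Real.log n ^ 2

lemma eventually_mul_log_le_bulkSize (C : ℝ) : ∀ᶠ n : ℕ in atTop, C * Real.log n ≤ bulkSize n := by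
  filter_upwards [tendsto_log_natCast.eventually (eventually_mul_pow_le_exp C zero_lt_one 3),
    tendsto_log_natCast.eventually_gt_atTop 0, eventually_gt_atTop 0] with n hexp hlog hn
  rw [one_mul, Real.exp_log (by exact_mod_cast hn)] at hexp
  rw [bulkSize, le_div_iff₀ (by positivity)]
  linarith

/-- The number `⌊β log n⌋`, the size of an independent set inside one part. -/
def logSize (β : ℝ) (n : ℕ) : ℕ := ⌊β * Real.log n⌋₊

lemma logSize_le {β : ℝ} (hβ : 0 ≤ β) (n : ℕ) : (logSize β n : ℝ) ≤ β * Real.log n :=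
  Nat.floor_le (mul_nonneg hβ (Real.log_natCast_nonneg n))

lemma tendsto_logSize_div_log {β : ℝ} (hβ : 0 ≤ β) :
    Tendsto (fun n => (logSize β n : ℝ) / Real.log n) atTop (𝓝 β) :=
  (tendsto_nat_floor_mul_div_atTop hβ).comp tendsto_log_natCast

lemma tendsto_logSize {β : ℝ} (hβ : 0 < β) : Tendsto (logSize β) atTop atTop :=
  tendsto_nat_floor_atTop.comp (tendsto_log_natCast.const_mul_atTop hβ)

lemma eventually_mul_log_mul_div_bulkSize_le (C : ℝ) {τ : ℝ} (hτ : 0 < τ) :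
    ∀ᶠ n : ℕ in atTop, C * Real.log n * (C * Real.log n / bulkSize n) ≤
      Real.exp (-((1 - τ) * Real.log n)) := by
  filter_upwards [tendsto_log_natCast.eventually (eventually_mul_pow_le_exp (C ^ 2) hτ 4),
    eventually_gt_atTop 0] with n hexp hn
  have hn' : (0 : ℝ) < n := by exact_mod_cast hn
  rw [show -((1 - τ) * Real.log n) = τ * Real.log n - Real.log n by ring, Real.exp_sub,
    Real.exp_log hn', bulkSize, div_div_eq_mul_div, mul_div_assoc']
  gcongr
  linarith

lemma eventually_two_pow_mul_exp_le :
    ∀ᶠ n : ℕ in atTop, (2 : ℝ) ^ n * Real.exp (-(1 / (6 * Real.exp (-(3 / 2 * Real.log n))))) ≤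
      Real.exp (-n) := by
  filter_upwards [tendsto_log_natCast.eventually (eventually_mul_pow_le_exp 12 one_half_pos 0),
    eventually_gt_atTop 0] with n hexp hn
  have hn' : (0 : ℝ) < n := by exact_mod_cast hn
  have hexponent : 2 * (n : ℝ) ≤ 1 / (6 * Real.exp (-(3 / 2 * Real.log n))) := by
    rw [show 3 / 2 * Real.log n = 1 / 2 * Real.log n + Real.log n by ring, Real.exp_neg,
      Real.exp_add, Real.exp_log hn', ← div_eq_mul_inv, one_div_div, le_div_iff₀ (by norm_num)]
    linarith [mul_le_mul_of_nonneg_right hexp hn'.le]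
  calc (2 : ℝ) ^ n * Real.exp (-(1 / (6 * Real.exp (-(3 / 2 * Real.log n)))))
      ≤ Real.exp 1 ^ n * Real.exp (-(2 * n)) := by
        gcongr
        linarith [Real.add_one_le_exp 1]
    _ = Real.exp (-n) := by
        rw [← Real.exp_nat_mul, ← Real.exp_add]
        ring_nf

variable {V : ℕ → Type*} [∀ n, Fintype (V n)] [∀ n, DecidableEq (V n)]
  {p : ∀ n, Sym2 (V n) → I} {X Y : ∀ n, Finset (V n)} {c₁ c₂ c₁₂ β₁ β₂ : ℝ}

lemma tendsto_independentEdges_not_hasProfileSets (hV : ∀ n, Fintype.card (V n) ≤ n)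
    (hp : ∀ n e, (p n e : ℝ) < 1)
    (hc : ∀ n, HasPairCosts (pairCost (p n)) (X n) (Y n) c₁ c₂ c₁₂) (hβ₁ : 0 < β₁) (hβ₂ : 0 ≤ β₂)
    (hsub : IsSubcritical c₁ c₂ c₁₂ β₁ β₂) :
    Tendsto (fun n => independentEdges (V n) (p n)
      {G | ¬ HasProfileSets G (X n) (Y n) (bulkSize n) (logSize β₁ n) (logSize β₂ n)})
      atTop (𝓝 0) := by
  obtain ⟨τ, hτ, hsub⟩ := hsub
  have hlim : Tendsto (fun n : ℕ => ENNReal.ofReal (Real.exp (-n))) atTop (𝓝 0) := by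
    simpa using ENNReal.tendsto_ofReal
      (Real.tendsto_exp_neg_atTop_nhds_zero.comp tendsto_natCast_atTop_atTop)
  refine tendsto_of_tendsto_of_tendsto_of_le_of_le' tendsto_const_nhds hlim
    (Eventually.of_forall fun n => zero_le) ?_
  filter_upwards [tendsto_log_natCast.eventually hsub, eventually_two_pow_mul_exp_le,
    eventually_mul_log_mul_div_bulkSize_le (β₁ + β₂) hτ,
    eventually_mul_log_le_bulkSize (β₁ + β₂), tendsto_log_natCast.eventually_gt_atTop 0]
    with n hcost hunion hratio hbulk hlog
  have hr : 0 < (β₁ + β₂) * Real.log n := by positivity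
  refine (independentEdges_not_hasProfileSets_le (hp n) (hc n) (hr.trans_le hbulk) hr
    (by linarith [logSize_le hβ₁.le n, logSize_le hβ₂ n]) hbulk
    (Real.exp_pos (-(3 / 2 * Real.log n))) fun u v hu hv huv => ?_).trans
    (ENNReal.ofReal_le_ofReal (le_trans ?_ hunion))
  · have hcost := hcost u v (le_trans (by exact_mod_cast hu) (logSize_le hβ₁.le n))
      (le_trans (by exact_mod_cast hv) (logSize_le hβ₂ n)) huv
    refine (mul_le_mul_of_nonneg_right (pow_le_pow_left₀ ?_ hratio _)
      (Real.exp_pos _).le).trans ?_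
    · exact mul_nonneg hr.le (div_nonneg hr.le (hr.trans_le hbulk).le)
    · rw [← Real.exp_nat_mul, ← Real.exp_add]
      push_cast
      exact Real.exp_le_exp.2 (by linarith)
  · gcongr
    · norm_num
    · exact hV n

end Bulk

section Coloring

variable {V : Type*} {G : SimpleGraph V}

lemma chi_le_of_colorable [Finite V] {t : ℕ} (h : G.Colorable t) : chi G ≤ t := by
  rw [chi]
  exact_mod_cast ENat.toNat_le_of_le_natCast h.chromaticNumber_le

lemma sum_le_chi_mul [Fintype V] (κ : V → ℝ) {θ : ℝ}
    (h : ∀ S : Finset V, G.IsIndepSet S → ∑ x ∈ S, κ x ≤ θ) : ∑ x, κ x ≤ chi G * θ := by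
  classical
  obtain ⟨C⟩ := G.colorable_chromaticNumber_of_fintype
  calc ∑ x, κ x = ∑ color, ∑ x with C x = color, κ x :=
        (Finset.sum_fiberwise Finset.univ C κ).symm
    _ ≤ ∑ _color : Fin G.chromaticNumber.toNat, θ := Finset.sum_le_sum fun color _ =>
        h _ (by simpa [SimpleGraph.Coloring.colorClass] using C.isIndepSet_colorClass color)
    _ = chi G * θ := by simp [chi]

variable [Finite V]

/-- The chromatic number of the subgraph of `G` induced on `U`. -/
def chiOn (G : SimpleGraph V) (U : Finset V) : ℝ := chi (G.induce (U : Set V))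

lemma chiOn_empty : chiOn G ∅ ≤ 0 := by
  exact_mod_cast chi_le_of_colorable (SimpleGraph.Colorable.of_isEmpty (V := (∅ : Finset V)) 0)

lemma chiOn_le_card (U : Finset V) : chiOn G U ≤ U.card := by
  simpa [chiOn] using chi_le_of_colorable (G.induce (U : Set V)).colorable_of_fintype

lemma chiOn_le_one_of_isIndepSet {S : Finset V} (hS : G.IsIndepSet S) : chiOn G S ≤ 1 := by
  have hbot : G.induce (S : Set V) = ⊥ := by
    ext u v
    simpa using fun huv => hS u.2 v.2 huv.ne huv
  exact_mod_cast chi_le_of_colorable (SimpleGraph.colorable_one_iff.2 hbot)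

lemma chi_eq_chiOn_univ [Fintype V] : chi G = chiOn G Finset.univ := by
  rw [chiOn, chi, chi, Finset.coe_univ,
    SimpleGraph.chromaticNumber_congr (SimpleGraph.induceUnivIso G)]

variable [DecidableEq V]

lemma chiOn_union_le (U W : Finset V) : chiOn G (U ∪ W) ≤ chiOn G U + chiOn G W := by
  obtain ⟨C⟩ := (G.induce (U : Set V)).colorable_chromaticNumber_of_fintype
  obtain ⟨D⟩ := (G.induce (W : Set V)).colorable_chromaticNumber_of_fintype
  let color (v : (↑(U ∪ W) : Set V)) :
      Fin (G.induce (U : Set V)).chromaticNumber.toNat ⊕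
        Fin (G.induce (W : Set V)).chromaticNumber.toNat :=
    if hU : v.1 ∈ U then .inl (C ⟨v, hU⟩)
    else .inr (D ⟨v, (Finset.mem_union.1 v.2).resolve_left hU⟩)
  have hcolor := (SimpleGraph.Coloring.mk (G := G.induce (↑(U ∪ W) : Set V)) color
    fun {u v} huv => by
      by_cases hu : u.1 ∈ U <;> by_cases hv : v.1 ∈ U <;>
        simp only [color, hu, hv, dif_pos, dif_neg, not_false_eq_true, ne_eq, Sum.inl.injEq,
          Sum.inr.injEq, reduceCtorEq]
      · exact C.valid huv
      · exact D.valid huv).colorable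
  simpa [chiOn, chi] using chi_le_of_colorable hcolor

lemma chiOn_biUnion_le {ι : Type*} (s : Finset ι) (U : ι → Finset V) :
    chiOn G (s.biUnion U) ≤ ∑ i ∈ s, chiOn G (U i) := by
  classical
  induction s using Finset.induction_on with
  | empty => simpa using chiOn_empty
  | insert i s hi ih =>
    rw [Finset.biUnion_insert, Finset.sum_insert hi]
    exact (chiOn_union_le _ _).trans (by gcongr)

lemma chi_le_chiOn_add_sum_chiOn_sdiff {ι : Type*} [Fintype ι] {X : ι → Finset V}
    (hX : ∀ v, ∃ i, v ∈ X i) (W : Finset V) : chi G ≤ chiOn G W + ∑ i, chiOn G (X i \ W) := by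
  have := Fintype.ofFinite V
  have hcover : W ∪ Finset.univ.biUnion (fun i => X i \ W) = Finset.univ := by
    ext v
    obtain ⟨i, hi⟩ := hX v
    simp only [Finset.mem_union, Finset.mem_biUnion, Finset.mem_univ, Finset.mem_sdiff, true_and,
      iff_true]
    exact or_iff_not_imp_left.2 fun hv => ⟨i, hi, hv⟩
  rw [chi_eq_chiOn_univ, ← hcover]
  exact (chiOn_union_le _ _).trans (by gcongr; exact chiOn_biUnion_le _ _)

end Coloring

section GreedyColoring

variable {V : Type*} [DecidableEq V] [Finite V] {G : SimpleGraph V} {X Y : Finset V} {m : ℝ}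
  {a b : ℕ}

lemma HasProfileSets.chiOn_le (ha : 0 < a) (h : HasProfileSets G X ∅ m a 0) {U : Finset V}
    (hU : U ⊆ X) : chiOn G U ≤ U.card / a + m := by
  induction U using Finset.strongInduction with
  | H U ih =>
    rcases le_total (U.card : ℝ) m with hsmall | hlarge
    · have : (0 : ℝ) ≤ U.card / a := by positivity
      linarith [chiOn_le_card (G := G) U]
    obtain ⟨S, hS, hindep⟩ := h U hU ∅ le_rfl hlarge (absurd · (lt_irrefl 0))
    obtain ⟨hSU, hSa, -⟩ := mem_profileSets.1 hS
    rw [Finset.union_empty] at hSU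
    rw [Finset.inter_eq_left.2 hSU] at hSa
    have hcard : ((U \ S).card : ℝ) = U.card - a := by
      rw [Finset.cast_card_sdiff hSU, hSa]
    have hrest := ih (U \ S) (Finset.sdiff_ssubset hSU (Finset.card_pos.1 (hSa ▸ ha)))
      (Finset.sdiff_subset.trans hU)
    calc chiOn G U = chiOn G (U \ S ∪ S) := by rw [Finset.sdiff_union_of_subset hSU]
      _ ≤ chiOn G (U \ S) + chiOn G S := chiOn_union_le _ _
      _ ≤ (U \ S).card / a + m + 1 := add_le_add hrest (chiOn_le_one_of_isIndepSet hindep)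
      _ = U.card / a + m := by
        rw [hcard]
        field_simp
        ring

lemma HasProfileSets.exists_chiOn_le (h : HasProfileSets G X Y m a b) (T : ℕ)
    (hX : m + a * T ≤ X.card) (hY : m + b * T ≤ Y.card) :
    ∃ W, chiOn G W ≤ T ∧ ((X \ W).card : ℝ) = X.card - a * T ∧
      ((Y \ W).card : ℝ) = Y.card - b * T := by
  induction T with
  | zero => exact ⟨∅, by simpa using chiOn_empty, by simp, by simp⟩
  | succ T ih =>
    push_cast at hX hY
    have : (0 : ℝ) ≤ a := Nat.cast_nonneg a
    have : (0 : ℝ) ≤ b := Nat.cast_nonneg b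
    obtain ⟨W, hchi, hXW, hYW⟩ := ih (by linarith) (by linarith)
    obtain ⟨S, hS, hindep⟩ := h (X \ W) Finset.sdiff_subset (Y \ W) Finset.sdiff_subset
      (by linarith) fun _ => by linarith
    obtain ⟨-, hSX, hSY⟩ := mem_profileSets.1 hS
    have hcard (Z : Finset V) : ((Z \ (W ∪ S)).card : ℝ) = (Z \ W).card - (S ∩ (Z \ W)).card := by
      rw [← Finset.sup_eq_union, ← sdiff_sdiff_left, Finset.inter_comm,
        ← Finset.card_sdiff_add_card_inter (Z \ W) S]
      push_cast
      ring
    refine ⟨W ∪ S, ?_, ?_, ?_⟩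
    · push_cast
      exact (chiOn_union_le _ _).trans (add_le_add hchi (chiOn_le_one_of_isIndepSet hindep))
    · rw [hcard, hSX, hXW]
      push_cast
      ring
    · rw [hcard, hSY, hYW]
      push_cast
      ring

variable {ι : Type*} [Fintype ι] {X : ι → Finset V} {s : ι → ℕ}

lemma chi_le_chiOn_add_sum_of_hasProfileSets (hX : ∀ v, ∃ l, v ∈ X l) (hs : ∀ l, 0 < s l)
    (hsolo : ∀ l, HasProfileSets G (X l) ∅ m (s l) 0) (W : Finset V) :
    chi G ≤ chiOn G W + ∑ l, (((X l \ W).card : ℝ) / s l + m) := by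
  refine (chi_le_chiOn_add_sum_chiOn_sdiff hX W).trans ?_
  gcongr with l
  exact (hsolo l).chiOn_le (hs l) Finset.sdiff_subset

lemma chi_le_sum_of_hasProfileSets (hX : ∀ v, ∃ l, v ∈ X l) (hs : ∀ l, 0 < s l)
    (hsolo : ∀ l, HasProfileSets G (X l) ∅ m (s l) 0) :
    chi G ≤ ∑ l, ((X l).card / s l + m) := by
  have hchi := chi_le_chiOn_add_sum_of_hasProfileSets hX hs hsolo ∅
  simp only [Finset.sdiff_empty] at hchi
  linarith [chiOn_empty (G := G)]

lemma chi_le_sum_add_of_hasProfileSets (hX : ∀ v, ∃ l, v ∈ X l)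
    (hs : ∀ l, 0 < s l) (hsolo : ∀ l, HasProfileSets G (X l) ∅ m (s l) 0) {i j : ι} (hij : i ≠ j)
    (hmixed : HasProfileSets G (X i) (X j) m a b) (T : ℕ) (hi : m + a * T ≤ (X i).card)
    (hj : m + b * T ≤ (X j).card) :
    chi G ≤ ∑ l, ((X l).card / s l + m) + T * (1 - a / s i - b / s j) := by
  classical
  obtain ⟨W, hW, hWi, hWj⟩ := hmixed.exists_chiOn_le T hi hj
  have hcard (l : ι) : ((X l \ W).card : ℝ) ≤
      (X l).card - (if l = i then (a * T : ℝ) else 0) - (if l = j then (b * T : ℝ) else 0) := by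
    have : ((X l \ W).card : ℝ) ≤ (X l).card := by gcongr; exact Finset.sdiff_subset
    split_ifs <;> grind
  calc chi G ≤ chiOn G W + ∑ l, (((X l \ W).card : ℝ) / s l + m) :=
        chi_le_chiOn_add_sum_of_hasProfileSets hX hs hsolo W
    _ ≤ T + ∑ l, (((X l).card - (if l = i then (a * T : ℝ) else 0) -
          (if l = j then (b * T : ℝ) else 0)) / s l + m) := by
        gcongr with l
        exact hcard l
    _ = ∑ l, ((X l).card / s l + m) + T * (1 - a / s i - b / s j) := by
        simp only [sub_div, ite_div, zero_div, Finset.sum_add_distrib, Finset.sum_sub_distrib,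
          Finset.sum_ite_eq', Finset.mem_univ, if_true]
        ring

end GreedyColoring

section Whp

variable {Ω : ℕ → Type*} [∀ n, MeasurableSpace (Ω n)] {μ : ∀ n, Measure (Ω n)}
  {V : ℕ → Type*} {ν : ∀ n, Measure (SimpleGraph (V n))}
  {G : ∀ n, Ω n → SimpleGraph (V n)}

/-- With high probability: the probability that `Φ n` fails tends to zero. -/
def Whp (μ : ∀ n, Measure (Ω n)) (Φ : ∀ n, Ω n → Prop) : Prop :=
  Tendsto (fun n => μ n {ω | ¬ Φ n ω}) atTop (𝓝 0)

namespace Whp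

variable {Φ Ψ : ∀ n, Ω n → Prop}

lemma mono (h : Whp μ Φ) (hΨ : ∀ᶠ n in atTop, ∀ ω, Φ n ω → Ψ n ω) : Whp μ Ψ :=
  tendsto_of_tendsto_of_tendsto_of_le_of_le' tendsto_const_nhds h
    (Eventually.of_forall fun _ => zero_le)
    (hΨ.mono fun _ hΨ => measure_mono fun ω => mt (hΨ ω))

lemma and (hΦ : Whp μ Φ) (hΨ : Whp μ Ψ) : Whp μ fun n ω => Φ n ω ∧ Ψ n ω := by
  have hadd := hΦ.add hΨ
  rw [add_zero] at hadd
  refine tendsto_of_tendsto_of_tendsto_of_le_of_le tendsto_const_nhds hadd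
    (fun _ => zero_le) fun n => ?_
  simp only [not_and_or, Set.ofPred_or]
  exact measure_union_le _ _

lemma all {ι : Type*} [Finite ι] {Φ : ι → ∀ n, Ω n → Prop} (h : ∀ i, Whp μ (Φ i)) :
    Whp μ fun n ω => ∀ i, Φ i n ω := by
  have := Fintype.ofFinite ι
  have hsum : Tendsto (fun n => ∑ i, μ n {ω | ¬ Φ i n ω}) atTop (𝓝 0) := by
    simpa using tendsto_finsetSum Finset.univ fun i _ => h i
  refine tendsto_of_tendsto_of_tendsto_of_le_of_le tendsto_const_nhds hsum
    (fun _ => zero_le) fun n => ?_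
  simp only [not_forall, Set.ofPred_exists]
  exact measure_iUnion_fintype_le _ _

lemma tendsto_one [∀ n, IsProbabilityMeasure (μ n)] (h : Whp μ Φ) :
    Tendsto (fun n => μ n {ω | Φ n ω}) atTop (𝓝 1) := by
  have hsub : Tendsto (fun n => 1 - μ n {ω | ¬ Φ n ω}) atTop (𝓝 1) := by
    simpa using ENNReal.Tendsto.sub tendsto_const_nhds h (Or.inl ENNReal.one_ne_top)
  refine tendsto_of_tendsto_of_tendsto_of_le_of_le hsub tendsto_const_nhds (fun n => ?_)
    fun n => prob_le_one
  rw [tsub_le_iff_right, ← measure_univ (μ := μ n), ← Set.union_compl_self {ω | Φ n ω}]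
  exact measure_union_le _ _

lemma comp_hasLaw [∀ n, Finite (V n)] {Φ : ∀ n, SimpleGraph (V n) → Prop} (h : Whp ν Φ)
    (hG : ∀ n, HasLaw (G n) (ν n) (μ n)) : Whp μ fun n ω => Φ n (G n ω) :=
  h.congr fun n => ((hG n).measure_eq (measurableSet_simpleGraph {G | ¬ Φ n G})).symm

end Whp

/-- With high probability `X n ≤ (ρ + o(1)) s n`. -/
def WhpUpper (μ : ∀ n, Measure (Ω n)) (s : ℕ → ℝ) (X : ∀ n, Ω n → ℝ) (ρ : ℝ) : Prop :=
  ∀ δ > 0, Whp μ fun n ω => X n ω ≤ (ρ + δ) * s n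

/-- With high probability `X n ≥ (ρ - o(1)) s n`. -/
def WhpLower (μ : ∀ n, Measure (Ω n)) (s : ℕ → ℝ) (X : ∀ n, Ω n → ℝ) (ρ : ℝ) : Prop :=
  ∀ δ > 0, Whp μ fun n ω => (ρ - δ) * s n ≤ X n ω

variable {s : ℕ → ℝ} {X Y : ∀ n, Ω n → ℝ} {ρ ρ' : ℝ}

lemma whpUpper_of_tendsto {E : Type*} {l : Filter E} [l.NeBot] {F : E → ℕ → ℝ} {L : E → ℝ}
    (hs : ∀ᶠ n in atTop, 0 < s n) (hX : ∀ᶠ ε in l, Whp μ fun n ω => X n ω ≤ F ε n)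
    (hF : ∀ᶠ ε in l, Tendsto (fun n => F ε n / s n) atTop (𝓝 (L ε))) (hL : Tendsto L l (𝓝 ρ)) :
    WhpUpper μ s X ρ := by
  intro δ hδ
  obtain ⟨ε, hX, hF, hL⟩ :=
    (hX.and (hF.and (hL.eventually (gt_mem_nhds (lt_add_of_pos_right ρ hδ))))).exists
  refine hX.mono ?_
  filter_upwards [hF.eventually (gt_mem_nhds hL), hs] with n hF hs ω hω
  exact hω.trans ((div_lt_iff₀ hs).1 hF).le

lemma whpLower_neg_iff : WhpLower μ s (fun n ω => -X n ω) (-ρ) ↔ WhpUpper μ s X ρ := by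
  have (δ : ℝ) (n : ℕ) (ω : Ω n) : (-ρ - δ) * s n ≤ -X n ω ↔ X n ω ≤ (ρ + δ) * s n := by
    rw [← neg_add', neg_mul, neg_le_neg_iff]
  simp only [WhpLower, WhpUpper, this]

lemma WhpUpper.comp_hasLaw [∀ n, Finite (V n)] {X : ∀ n, SimpleGraph (V n) → ℝ}
    (h : WhpUpper ν s X ρ) (hG : ∀ n, HasLaw (G n) (ν n) (μ n)) :
    WhpUpper μ s (fun n ω => X n (G n ω)) ρ :=
  fun δ hδ => (h δ hδ).comp_hasLaw hG

lemma WhpLower.comp_hasLaw [∀ n, Finite (V n)] {X : ∀ n, SimpleGraph (V n) → ℝ}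
    (h : WhpLower ν s X ρ) (hG : ∀ n, HasLaw (G n) (ν n) (μ n)) :
    WhpLower μ s (fun n ω => X n (G n ω)) ρ :=
  fun δ hδ => (h δ hδ).comp_hasLaw hG

lemma WhpUpper.sum {ι : Type*} [Fintype ι] {X : ι → ∀ n, Ω n → ℝ} {ρ : ι → ℝ}
    (h : ∀ i, WhpUpper μ s (X i) (ρ i)) (hs : ∀ n, 0 ≤ s n) :
    WhpUpper μ s (fun n ω => ∑ i, X i n ω) (∑ i, ρ i) := by
  intro δ hδ
  refine (Whp.all fun i => h i (δ / (Fintype.card ι + 1)) (by positivity)).mono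
    (Eventually.of_forall fun n ω hX => ?_)
  have hδ' : Fintype.card ι * (δ / (Fintype.card ι + 1)) ≤ δ := by
    rw [mul_div_assoc', div_le_iff₀ (by positivity)]
    linarith
  calc ∑ i, X i n ω ≤ ∑ i, (ρ i + δ / (Fintype.card ι + 1)) * s n :=
        Finset.sum_le_sum fun i _ => hX i
    _ = (∑ i, ρ i + Fintype.card ι * (δ / (Fintype.card ι + 1))) * s n := by
        rw [← Finset.sum_mul, Finset.sum_add_distrib, Finset.sum_const, Finset.card_univ,
          nsmul_eq_mul]
    _ ≤ (∑ i, ρ i + δ) * s n := by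
        gcongr
        exact hs n

lemma WhpLower.sum {ι : Type*} [Fintype ι] {X : ι → ∀ n, Ω n → ℝ} {ρ : ι → ℝ}
    (h : ∀ i, WhpLower μ s (X i) (ρ i)) (hs : ∀ n, 0 ≤ s n) :
    WhpLower μ s (fun n ω => ∑ i, X i n ω) (∑ i, ρ i) := by
  have hneg := WhpUpper.sum (X := fun i n ω => -X i n ω) (ρ := fun i => -ρ i)
    (fun i => whpLower_neg_iff.1 (by simpa using h i)) hs
  simpa using whpLower_neg_iff.2 hneg

lemma whpAsymptoticallyEq_of_whpUpper_of_whpLower [∀ n, IsProbabilityMeasure (μ n)] (hρ : 0 < ρ)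
    (hXu : WhpUpper μ s X ρ) (hXl : WhpLower μ s X ρ) (hYu : WhpUpper μ s Y ρ)
    (hYl : WhpLower μ s Y ρ) : WhpAsymptoticallyEq μ X Y := by
  intro ε hε
  set δ := ε * ρ / (2 + ε) with hδ_def
  have hδ : 0 < δ := by positivity
  have hδε : 2 * δ = ε * (ρ - δ) := by
    rw [hδ_def]
    field_simp
    ring
  refine (((hXu δ hδ).and (hXl δ hδ)).and ((hYu δ hδ).and (hYl δ hδ))).mono
    (Eventually.of_forall fun n ω hω => ?_) |>.tendsto_one
  obtain ⟨⟨hXu, hXl⟩, hYu, hYl⟩ := hω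
  calc |X n ω - Y n ω| ≤ 2 * δ * s n := abs_le.2 ⟨by linarith, by linarith⟩
    _ = ε * ((ρ - δ) * s n) := by rw [hδε, mul_assoc]
    _ ≤ ε * Y n ω := by gcongr

lemma not_whpAsymptoticallyEq_of_whpUpper_of_whpLower (hρ : ρ < ρ')
    (hs : ∀ᶠ n in atTop, 0 < s n) (hX : WhpUpper μ s X ρ) (hY : WhpLower μ s Y ρ') :
    ¬ WhpAsymptoticallyEq μ X Y := by
  intro h
  obtain ⟨ε, hε, hε₀, hε₁⟩ : ∃ ε : ℝ, ρ + ε < (1 - ε) * (ρ' - ε) ∧ 0 < ε ∧ ε < 1 := by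
    have hcont : ContinuousAt (fun ε : ℝ => (1 - ε) * (ρ' - ε) - ε) 0 := by fun_prop
    have hnear : ∀ᶠ ε : ℝ in 𝓝[>] 0, ρ < (1 - ε) * (ρ' - ε) - ε :=
      nhdsWithin_le_nhds (hcont.eventually (lt_mem_nhds (by simpa using hρ)))
    exact ((hnear.mono fun _ => lt_sub_iff_add_lt.1).and
      (Ioo_mem_nhdsGT zero_lt_one)).exists
  have hfail : Whp μ fun n ω => ¬ |X n ω - Y n ω| ≤ ε * Y n ω := by
    refine ((hX ε hε₀).and (hY ε hε₀)).mono (hs.mono fun n hs ω hω hXY => ?_)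
    have hupper := mul_lt_mul_of_pos_right hε hs
    have hlower := mul_le_mul_of_nonneg_left hω.2 (sub_nonneg.2 hε₁.le)
    linarith [(abs_le.1 hXY).1, hω.1]
  simp only [Whp, not_not] at hfail
  exact zero_ne_one (tendsto_nhds_unique hfail (h ε hε₀))

end Whp

section Asymptotics

/-- The order of magnitude `n / log n` of the chromatic numbers of the random graphs below. -/
def chromaticScale (n : ℕ) : ℝ := n / Real.log n

lemma chromaticScale_nonneg (n : ℕ) : 0 ≤ chromaticScale n :=
  div_nonneg (Nat.cast_nonneg n) (Real.log_natCast_nonneg n)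

lemma eventually_chromaticScale_pos : ∀ᶠ n in atTop, 0 < chromaticScale n := by
  filter_upwards [eventually_gt_atTop 0, tendsto_log_natCast.eventually_gt_atTop 0] with n hn hlog
  exact div_pos (by exact_mod_cast hn) hlog

lemma tendsto_chromaticScale : Tendsto chromaticScale atTop atTop := by
  refine tendsto_atTop_mono' atTop ?_ tendsto_log_natCast
  filter_upwards [eventually_mul_log_le_bulkSize 1, tendsto_log_natCast.eventually_ge_atTop 1]
    with n hbulk hlog
  have hlog_sq : Real.log n ≤ Real.log n ^ 2 := le_self_pow₀ hlog two_ne_zero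
  calc Real.log n ≤ bulkSize n := by rwa [one_mul] at hbulk
    _ ≤ chromaticScale n := by
      rw [bulkSize, chromaticScale]
      gcongr

lemma tendsto_bulkSize_div_chromaticScale :
    Tendsto (fun n => bulkSize n / chromaticScale n) atTop (𝓝 0) := by
  refine (tendsto_inv_atTop_zero.comp tendsto_log_natCast).congr' ?_
  filter_upwards [eventually_ne_atTop 0, tendsto_log_natCast.eventually_ne_atTop 0] with n hn hlog
  simp only [Function.comp, bulkSize, chromaticScale]
  field_simp

lemma tendsto_bulkSize_div : Tendsto (fun n : ℕ => bulkSize n / n) atTop (𝓝 0) := by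
  have hlog : Tendsto (fun n : ℕ => (Real.log n)⁻¹) atTop (𝓝 0) :=
    tendsto_inv_atTop_zero.comp tendsto_log_natCast
  have hmul := tendsto_bulkSize_div_chromaticScale.mul hlog
  rw [mul_zero] at hmul
  refine hmul.congr' ?_
  filter_upwards [tendsto_log_natCast.eventually_ne_atTop 0] with n hlog
  rw [chromaticScale]
  field_simp

lemma tendsto_logSize_div_logSize {β γ : ℝ} (hβ : 0 ≤ β) (hγ : 0 < γ) :
    Tendsto (fun n => (logSize β n : ℝ) / logSize γ n) atTop (𝓝 (β / γ)) := by
  refine ((tendsto_logSize_div_log hβ).div (tendsto_logSize_div_log hγ.le) hγ.ne').congr' ?_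
  filter_upwards [tendsto_log_natCast.eventually_ne_atTop 0] with n hlog
  exact div_div_div_cancel_right₀ hlog _ _

lemma tendsto_floor_mul_chromaticScale_div {t : ℝ} (ht : 0 ≤ t) :
    Tendsto (fun n => (⌊t * chromaticScale n⌋₊ : ℝ) / chromaticScale n) atTop (𝓝 t) :=
  (tendsto_nat_floor_mul_div_atTop ht).comp tendsto_chromaticScale

lemma eventually_bulkSize_add_logSize_mul_floor_le {N : ℕ → ℝ} {a β t : ℝ}
    (hN : Tendsto (fun n => N n / n) atTop (𝓝 a)) (hβ : 0 ≤ β) (ht : 0 ≤ t) (ha : t * β < a) :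
    ∀ᶠ n in atTop, bulkSize n + logSize β n * ⌊t * chromaticScale n⌋₊ ≤ N n := by
  have hgap := hN.sub tendsto_bulkSize_div
  rw [sub_zero] at hgap
  filter_upwards [hgap.eventually (lt_mem_nhds ha), eventually_gt_atTop 0,
    tendsto_log_natCast.eventually_gt_atTop 0] with n hgap hn hlog
  rw [← sub_div, lt_div_iff₀ (by exact_mod_cast hn), lt_sub_iff_add_lt'] at hgap
  have hcover : logSize β n * ⌊t * chromaticScale n⌋₊ ≤ t * β * n := by
    calc (logSize β n * ⌊t * chromaticScale n⌋₊ : ℝ)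
        ≤ β * Real.log n * (t * chromaticScale n) := by
          have := chromaticScale_nonneg n
          gcongr
          · exact logSize_le hβ n
          · exact Nat.floor_le (by positivity)
      _ = t * β * n := by
          rw [chromaticScale]
          field_simp
  linarith

lemma tendsto_sum_div_logSize_add_bulkSize {ι : Type*} [Fintype ι] {N : ι → ℕ → ℝ} {α β : ι → ℝ}
    (hN : ∀ i, Tendsto (fun n => N i n / n) atTop (𝓝 (α i))) (hβ : ∀ i, 0 < β i) :
    Tendsto (fun n => (∑ i, (N i n / logSize (β i) n + bulkSize n)) / chromaticScale n) atTop
      (𝓝 (∑ i, α i / β i)) := by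
  have hterm (i : ι) : Tendsto (fun n => N i n / n / (logSize (β i) n / Real.log n) +
      bulkSize n / chromaticScale n) atTop (𝓝 (α i / β i)) := by
    simpa using ((hN i).div (tendsto_logSize_div_log (hβ i).le) (hβ i).ne').add
      tendsto_bulkSize_div_chromaticScale
  refine (tendsto_finsetSum Finset.univ fun i _ => hterm i).congr fun n => ?_
  rw [Finset.sum_div]
  refine Finset.sum_congr rfl fun i _ => ?_
  rw [add_div, chromaticScale, div_div_div_comm]

lemma tendsto_sum_div_two_sub_div {ι : Type*} [Fintype ι] (α c : ι → ℝ) :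
    Tendsto (fun ε => ∑ i, α i / ((2 - ε) / c i)) (𝓝[>] 0) (𝓝 ((∑ i, α i * c i) / 2)) := by
  have hcont : ContinuousAt (fun ε : ℝ => (∑ i, α i * c i) / (2 - ε)) 0 := by
    fun_prop (disch := norm_num)
  have hlim := hcont.continuousWithinAt (s := Set.Ioi 0) |>.tendsto
  rw [sub_zero] at hlim
  refine hlim.congr fun ε => ?_
  rw [Finset.sum_div]
  exact Finset.sum_congr rfl fun i _ => (div_div_eq_mul_div _ _ _).symm

end Asymptotics

section FirstMoment

variable {V : ℕ → Type*} [∀ n, Fintype (V n)] [∀ n, DecidableEq (V n)]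
  {p : ∀ n, Sym2 (V n) → I}

theorem whpLower_chi_of_half_add_le_pairCost (hV : ∀ n, Fintype.card (V n) ≤ n)
    (hp : ∀ n e, (p n e : ℝ) < 1) {κ : ∀ n, V n → ℝ} {K w : ℝ} (hK : 0 < K)
    (hκ : ∀ n x, κ n x ≤ K)
    (hcost : ∀ n x y, x ≠ y → (κ n x + κ n y) / 2 ≤ pairCost (p n) s(x, y))
    (hw : Tendsto (fun n => (∑ x, κ n x) / n) atTop (𝓝 w)) :
    WhpLower (fun n => independentEdges (V n) (p n)) chromaticScale (fun _ G => chi G) (w / 2) := by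
  intro δ hδ
  obtain ⟨ε, hεw, hε⟩ : ∃ ε : ℝ, (w / 2 - δ) * (2 + ε) < w ∧ 0 < ε := by
    have hcont : ContinuousAt (fun ε : ℝ => (w / 2 - δ) * (2 + ε)) 0 := by fun_prop
    have hnear : ∀ᶠ ε : ℝ in 𝓝[>] 0, (w / 2 - δ) * (2 + ε) < w :=
      nhdsWithin_le_nhds (hcont.eventually (gt_mem_nhds (by dsimp only; linarith)))
    exact (hnear.and self_mem_nhdsWithin).exists
  have hlim : Tendsto (fun n : ℕ => ENNReal.ofReal (Real.exp 1 / n)) atTop (𝓝 0) := by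
    simpa using ENNReal.tendsto_ofReal (tendsto_const_div_atTop_nhds_zero_nat (Real.exp 1))
  have hlarge : Tendsto (fun n : ℕ => ε / 2 * ((2 + ε) * Real.log n / K - 1)) atTop atTop :=
    .const_mul_atTop (by positivity) (tendsto_atTop_add_const_right _ _
      ((tendsto_log_natCast.const_mul_atTop (by positivity)).atTop_div_const hK))
  have hlight : Whp (fun n => independentEdges (V n) (p n)) fun n G =>
      ∀ S : Finset (V n), G.IsIndepSet S → ∑ x ∈ S, κ n x ≤ (2 + ε) * Real.log n := by
    refine tendsto_of_tendsto_of_tendsto_of_le_of_le' tendsto_const_nhds hlim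
      (Eventually.of_forall fun _ => zero_le) ?_
    filter_upwards [hlarge.eventually_ge_atTop 2, eventually_gt_atTop 0] with n hlarge hn
    refine (measure_mono fun G hG => ?_).trans (independentEdges_exists_heavy_isIndepSet_le (hp n)
      hK (hκ n) (hcost n) hn (hV n) hε hlarge)
    obtain ⟨S, hS, hheavy⟩ : ∃ S : Finset (V n), G.IsIndepSet S ∧
        (2 + ε) * Real.log n < ∑ x ∈ S, κ n x := by simpa using hG
    exact ⟨S, hheavy.le, hS⟩
  refine hlight.mono ?_
  filter_upwards [eventually_gt_atTop 0, tendsto_log_natCast.eventually_gt_atTop 0,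
    hw.eventually (lt_mem_nhds hεw)] with n hn hlog hw G hG
  have hchi := sum_le_chi_mul (κ n) hG
  rw [lt_div_iff₀ (by exact_mod_cast hn)] at hw
  rw [chromaticScale, mul_div_assoc', div_le_iff₀ hlog]
  refine le_of_mul_le_mul_right (a := 2 + ε) ?_ (by linarith)
  linarith

end FirstMoment

section BlockSequence

variable {ι : Type*} [DecidableEq ι]

/-- The part with index `i` of the partition of `V` given by `π : V → ι`. -/
def part {V : Type*} [Fintype V] (π : V → ι) (i : ι) : Finset V := {x | π x = i}

lemma mem_part {V : Type*} [Fintype V] {π : V → ι} {i : ι} {x : V} : x ∈ part π i ↔ π x = i := by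
  simp [part]

variable {V : ℕ → Type*} [∀ n, Fintype (V n)]

/-- Edge probabilities `p n` on vertex sets `V n` of at most `n` vertices with a block structure:
`V n` is partitioned into the parts of `π n : V n → ι`, the `i`-th of which has density `α i`
asymptotically, and the cost of a pair of vertices depends only on their parts, as given by `c`. -/
structure IsBlockSequence (p : ∀ n, Sym2 (V n) → I) (π : ∀ n, V n → ι) (c : ι → ι → ℝ)
    (α : ι → ℝ) : Prop where
  card_le n : Fintype.card (V n) ≤ n
  lt_one n e : (p n e : ℝ) < 1
  cost_eq n x y : x ≠ y → pairCost (p n) s(x, y) = c (π n x) (π n y)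
  cost_pos i : 0 < c i i
  tendsto_card i : Tendsto (fun n => ((part (π n) i).card : ℝ) / n) atTop (𝓝 (α i))

namespace IsBlockSequence

variable {p : ∀ n, Sym2 (V n) → I} {π : ∀ n, V n → ι} {c : ι → ι → ℝ} {α : ι → ℝ}

lemma hasPairCosts_solo (h : IsBlockSequence p π c α) (n : ℕ) (i : ι) :
    HasPairCosts (pairCost (p n)) (part (π n) i) ∅ (c i i) 0 0 where
  disjoint := disjoint_bot_right
  left x hx y hy hxy := by rw [h.cost_eq n x y hxy, mem_part.1 hx, mem_part.1 hy]
  right := by simp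
  cross := by simp

lemma hasPairCosts_mixed (h : IsBlockSequence p π c α) (n : ℕ) {i j : ι} (hij : i ≠ j) :
    HasPairCosts (pairCost (p n)) (part (π n) i) (part (π n) j) (c i i) (c j j) (c i j) where
  disjoint := Finset.disjoint_left.2 fun x hxi hxj => hij (mem_part.1 hxi ▸ mem_part.1 hxj)
  left := (h.hasPairCosts_solo n i).left
  right := (h.hasPairCosts_solo n j).left
  cross x hx y hy := by
    rw [h.cost_eq n x y (by grind [mem_part]), mem_part.1 hx, mem_part.1 hy]

lemma tendsto_sum_cost [Fintype ι] (h : IsBlockSequence p π c α) :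
    Tendsto (fun n => (∑ x, c (π n x) (π n x)) / n) atTop (𝓝 (∑ i, α i * c i i)) := by
  refine (tendsto_finsetSum Finset.univ fun i _ =>
    (h.tendsto_card i).mul_const (c i i)).congr fun n => ?_
  rw [← Finset.sum_fiberwise Finset.univ (π n), Finset.sum_div]
  refine Finset.sum_congr rfl fun i _ => ?_
  rw [Finset.sum_congr rfl (g := fun _ => c i i) fun x hx => by rw [(Finset.mem_filter.1 hx).2],
    Finset.sum_const, nsmul_eq_mul, div_mul_eq_mul_div, part]

lemma eventually_logSize_pos [Finite ι] (h : IsBlockSequence p π c α) {ε : ℝ} (hε : ε < 2) :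
    ∀ᶠ n in atTop, ∀ i, 0 < logSize ((2 - ε) / c i i) n :=
  eventually_all.2 fun i =>
    (tendsto_logSize (div_pos (by linarith) (h.cost_pos i))).eventually_gt_atTop 0

variable [∀ n, DecidableEq (V n)]

lemma whp_hasProfileSets_solo [Finite ι] (h : IsBlockSequence p π c α) {ε : ℝ} (hε : 0 < ε)
    (hε' : ε ≤ 1 / 2) : Whp (fun n => independentEdges (V n) (p n)) fun n G => ∀ i,
      HasProfileSets G (part (π n) i) ∅ (bulkSize n) (logSize ((2 - ε) / c i i) n) 0 := by
  refine Whp.all fun i => ?_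
  have hsolo := tendsto_independentEdges_not_hasProfileSets h.card_le h.lt_one
    (fun n => h.hasPairCosts_solo n i) (div_pos (by linarith) (h.cost_pos i)) le_rfl
    (isSubcritical_solo (h.cost_pos i) hε hε')
  simpa only [Whp, logSize, zero_mul, Nat.floor_zero] using hsolo

variable [Fintype ι]

theorem whpLower_chi (h : IsBlockSequence p π c α) (hc : ∀ i j, (c i i + c j j) / 2 ≤ c i j) :
    WhpLower (fun n => independentEdges (V n) (p n)) chromaticScale (fun _ G => chi G)
      ((∑ i, α i * c i i) / 2) := by
  have hK : 0 < ∑ i, c i i + 1 :=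
    add_pos_of_nonneg_of_pos (Finset.sum_nonneg fun i _ => (h.cost_pos i).le) one_pos
  refine whpLower_chi_of_half_add_le_pairCost h.card_le h.lt_one hK (fun n x => ?_)
    (fun n x y hxy => (hc _ _).trans (h.cost_eq n x y hxy).ge) h.tendsto_sum_cost
  have := Finset.single_le_sum (fun i _ => (h.cost_pos i).le) (Finset.mem_univ (π n x))
  linarith

theorem whpUpper_chi (h : IsBlockSequence p π c α) :
    WhpUpper (fun n => independentEdges (V n) (p n)) chromaticScale (fun _ G => chi G)
      ((∑ i, α i * c i i) / 2) := by
  refine whpUpper_of_tendsto (F := fun ε n =>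
      ∑ i, (((part (π n) i).card : ℝ) / logSize ((2 - ε) / c i i) n + bulkSize n))
    eventually_chromaticScale_pos ?_ ?_ (tendsto_sum_div_two_sub_div α fun i => c i i)
  · filter_upwards [Ioc_mem_nhdsGT one_half_pos] with ε ⟨hε, hε'⟩
    refine (h.whp_hasProfileSets_solo hε hε').mono ?_
    filter_upwards [h.eventually_logSize_pos (by linarith : ε < 2)] with n hpos G hsolo
    exact chi_le_sum_of_hasProfileSets (fun x => ⟨π n x, mem_part.2 rfl⟩) hpos hsolo
  · filter_upwards [Ioc_mem_nhdsGT one_half_pos] with ε ⟨hε, hε'⟩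
    exact tendsto_sum_div_logSize_add_bulkSize h.tendsto_card
      fun i => div_pos (by linarith) (h.cost_pos i)

lemma whp_chi_le_sum_add (h : IsBlockSequence p π c α) {ε : ℝ} (hε : 0 < ε) (hε' : ε ≤ 1 / 2)
    {i j : ι} (hij : i ≠ j) {β₁ β₂ t : ℝ} (hβ₁ : 0 < β₁) (hβ₂ : 0 ≤ β₂)
    (hsub : IsSubcritical (c i i) (c j j) (c i j) β₁ β₂) (ht : 0 ≤ t) (hi : t * β₁ < α i)
    (hj : t * β₂ < α j) : Whp (fun n => independentEdges (V n) (p n)) fun n G =>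
      chi G ≤ ∑ l, ((part (π n) l).card / logSize ((2 - ε) / c l l) n + bulkSize n) +
        ⌊t * chromaticScale n⌋₊ * (1 - logSize β₁ n / logSize ((2 - ε) / c i i) n -
          logSize β₂ n / logSize ((2 - ε) / c j j) n) := by
  have hmixed : Whp (fun n => independentEdges (V n) (p n)) fun n G =>
      HasProfileSets G (part (π n) i) (part (π n) j) (bulkSize n) (logSize β₁ n) (logSize β₂ n) :=
    tendsto_independentEdges_not_hasProfileSets h.card_le h.lt_one
      (fun n => h.hasPairCosts_mixed n hij) hβ₁ hβ₂ hsub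
  refine ((h.whp_hasProfileSets_solo hε hε').and hmixed).mono ?_
  filter_upwards [h.eventually_logSize_pos (by linarith : ε < 2),
    eventually_bulkSize_add_logSize_mul_floor_le (h.tendsto_card i) hβ₁.le ht hi,
    eventually_bulkSize_add_logSize_mul_floor_le (h.tendsto_card j) hβ₂ ht hj]
    with n hpos hi hj G ⟨hsolo, hmixed⟩
  exact chi_le_sum_add_of_hasProfileSets (fun x => ⟨π n x, mem_part.2 rfl⟩) hpos hsolo hij hmixed _
    hi hj

lemma whpUpper_chi_of_isSubcritical (h : IsBlockSequence p π c α) {i j : ι} (hij : i ≠ j)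
    {β₁ β₂ t : ℝ} (hβ₁ : 0 < β₁) (hβ₂ : 0 ≤ β₂)
    (hsub : IsSubcritical (c i i) (c j j) (c i j) β₁ β₂) (ht : 0 ≤ t) (hi : t * β₁ < α i)
    (hj : t * β₂ < α j) :
    WhpUpper (fun n => independentEdges (V n) (p n)) chromaticScale (fun _ G => chi G)
      ((∑ l, α l * c l l) / 2 + t * (1 - β₁ * c i i / 2 - β₂ * c j j / 2)) := by
  refine whpUpper_of_tendsto (l := 𝓝[>] 0) (L := fun ε => ∑ l, α l / ((2 - ε) / c l l) +
      t * (1 - β₁ / ((2 - ε) / c i i) - β₂ / ((2 - ε) / c j j))) eventually_chromaticScale_pos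
    (Filter.mem_of_superset (Ioc_mem_nhdsGT one_half_pos) fun ε ⟨hε, hε'⟩ =>
      h.whp_chi_le_sum_add hε hε' hij hβ₁ hβ₂ hsub ht hi hj) ?_ ?_
  · filter_upwards [Ioc_mem_nhdsGT one_half_pos] with ε ⟨hε, hε'⟩
    have hs (l : ι) : 0 < (2 - ε) / c l l := div_pos (by linarith) (h.cost_pos l)
    have hgain := (tendsto_floor_mul_chromaticScale_div ht).mul
      ((tendsto_const_nhds (x := (1 : ℝ))).sub (tendsto_logSize_div_logSize hβ₁.le (hs i)) |>.sub
        (tendsto_logSize_div_logSize hβ₂ (hs j)))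
    refine ((tendsto_sum_div_logSize_add_bulkSize h.tendsto_card hs).add hgain).congr fun n => ?_
    rw [add_div, mul_div_right_comm]
  · refine (tendsto_sum_div_two_sub_div α fun l => c l l).add (Tendsto.const_mul t ?_)
    have hcont : ContinuousAt (fun ε : ℝ =>
        1 - β₁ * c i i / (2 - ε) - β₂ * c j j / (2 - ε)) 0 := by
      fun_prop (disch := norm_num)
    have hlim := hcont.continuousWithinAt (s := Set.Ioi 0) |>.tendsto
    simpa only [sub_zero, div_div_eq_mul_div] using hlim

theorem exists_whpUpper_chi_lt (h : IsBlockSequence p π c α) {i j : ι} (hij : i ≠ j)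
    (hc : c i j < (c i i + c j j) / 2) (hαi : 0 < α i) (hαj : 0 < α j) :
    ∃ ρ < (∑ l, α l * c l l) / 2,
      WhpUpper (fun n => independentEdges (V n) (p n)) chromaticScale (fun _ G => chi G) ρ := by
  have hci := h.cost_pos i
  have hcj := h.cost_pos j
  obtain ⟨η, hη, hsub⟩ := exists_isSubcritical_mixed hci hcj hc
  have hβ₂ : 0 < (1 + η) / c j j := by positivity
  obtain ⟨t, ht, ht_lt⟩ := exists_between (lt_min (mul_pos hαi hci) (div_pos hαj hβ₂))
  obtain ⟨hti, htj⟩ := lt_min_iff.1 ht_lt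
  refine ⟨_, ?_, h.whpUpper_chi_of_isSubcritical hij (one_div_pos.2 hci) hβ₂.le hsub ht.le
    (by rwa [mul_one_div, div_lt_iff₀ hci]) ((lt_div_iff₀ hβ₂).1 htj)⟩
  rw [div_mul_cancel₀ _ hci.ne', div_mul_cancel₀ _ hcj.ne']
  linarith [mul_pos ht hη]

end IsBlockSequence

end BlockSequence

section BlockSize

variable {k : ℕ} {α : Fin k → ℝ}

lemma sum_eq_sum_filter_add_last {M : Type*} [AddCommMonoid M] (f : Fin k → M) {i : Fin k}
    (hi : (i : ℕ) + 1 = k) :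
    ∑ j, f j = ∑ j ∈ Finset.univ.filter (fun j : Fin k => (j : ℕ) + 1 < k), f j + f i := by
  rw [← Finset.sum_filter_add_sum_filter_not Finset.univ (fun j : Fin k => (j : ℕ) + 1 < k),
    show Finset.univ.filter (fun j : Fin k => ¬ (j : ℕ) + 1 < k) = {i} by grind,
    Finset.sum_singleton]

lemma sum_floor_mul_le (hα : ∀ i, 0 ≤ α i) (hsum : ∑ i, α i = 1) (s : Finset (Fin k)) (n : ℕ) :
    ∑ j ∈ s, ⌊α j * n⌋₊ ≤ n := by
  have hmul (j : Fin k) : 0 ≤ α j * n := mul_nonneg (hα j) n.cast_nonneg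
  have hreal : (∑ j ∈ s, ⌊α j * n⌋₊ : ℝ) ≤ n :=
    calc (∑ j ∈ s, ⌊α j * n⌋₊ : ℝ) ≤ ∑ j ∈ s, α j * n :=
          Finset.sum_le_sum fun j _ => Nat.floor_le (hmul j)
      _ ≤ ∑ j, α j * n :=
          Finset.sum_le_sum_of_subset_of_nonneg s.subset_univ fun j _ _ => hmul j
      _ = n := by rw [← Finset.sum_mul, hsum, one_mul]
  exact_mod_cast hreal

lemma pos_of_sum_eq_one (hsum : ∑ i, α i = 1) : 0 < k := by
  rw [Nat.pos_iff_ne_zero]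
  rintro rfl
  simp at hsum

lemma sum_blockSize (hα : ∀ i, 0 ≤ α i) (hsum : ∑ i, α i = 1) (n : ℕ) :
    ∑ i, blockSize α n i = n := by
  obtain ⟨i, hi⟩ : ∃ i : Fin k, (i : ℕ) + 1 = k :=
    ⟨⟨k - 1, Nat.sub_one_lt (pos_of_sum_eq_one hsum).ne'⟩,
      Nat.sub_one_add_one (pos_of_sum_eq_one hsum).ne'⟩
  have hfloor : ∑ j ∈ Finset.univ.filter (fun j : Fin k => (j : ℕ) + 1 < k), blockSize α n j =
      ∑ j ∈ Finset.univ.filter (fun j : Fin k => (j : ℕ) + 1 < k), ⌊α j * n⌋₊ :=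
    Finset.sum_congr rfl fun j hj => if_neg (Finset.mem_filter.1 hj).2.ne
  rw [sum_eq_sum_filter_add_last _ hi, hfloor, blockSize, if_pos hi,
    Nat.add_sub_cancel' (sum_floor_mul_le hα hsum _ n)]

lemma blockSize_le (hα : ∀ i, 0 ≤ α i) (hsum : ∑ i, α i = 1) (n : ℕ) (i : Fin k) :
    blockSize α n i ≤ n :=
  (Finset.single_le_sum (fun _ _ => Nat.zero_le _) (Finset.mem_univ i)).trans
    (sum_blockSize hα hsum n).le

lemma tendsto_blockSize_div (hα : ∀ i, 0 ≤ α i) (hsum : ∑ i, α i = 1) (i : Fin k) :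
    Tendsto (fun n => (blockSize α n i : ℝ) / n) atTop (𝓝 (α i)) := by
  have hfloor (j : Fin k) : Tendsto (fun n : ℕ => (⌊α j * n⌋₊ : ℝ) / n) atTop (𝓝 (α j)) :=
    (tendsto_nat_floor_mul_div_atTop (hα j)).comp tendsto_natCast_atTop_atTop
  by_cases hi : (i : ℕ) + 1 = k
  · have hrest : 1 - ∑ j ∈ Finset.univ.filter (fun j : Fin k => (j : ℕ) + 1 < k), α j = α i := by
      rw [← hsum, sum_eq_sum_filter_add_last α hi, add_sub_cancel_left]
    rw [← hrest]
    refine (tendsto_const_nhds.sub (tendsto_finsetSum _ fun j _ => hfloor j)).congr' ?_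
    filter_upwards [eventually_ne_atTop 0] with n hn
    rw [blockSize, if_pos hi, Nat.cast_sub (sum_floor_mul_le hα hsum _ n), sub_div,
      div_self (Nat.cast_ne_zero.2 hn), Nat.cast_sum, Finset.sum_div]
  · simpa only [blockSize, if_neg hi] using hfloor i

end BlockSize

section BlockCost

/-- The cost `-log (1 - p_ij)` of a pair of vertices from `V_i` and `V_j`. -/
def blockCost {k : ℕ} (P : Matrix (Fin k) (Fin k) I) (i j : Fin k) : ℝ := -Real.log (1 - P i j)

lemma neg_log_one_sub_pos {q : ℝ} (hq₀ : 0 < q) (hq₁ : q < 1) : 0 < -Real.log (1 - q) :=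
  neg_pos.2 (Real.log_neg (by linarith) (by linarith))

lemma half_add_neg_log_le_iff {p q r : ℝ} (hp : p < 1) (hq : q < 1) (hr : r < 1) :
    (-Real.log (1 - p) + -Real.log (1 - q)) / 2 ≤ -Real.log (1 - r) ↔
      1 - Real.sqrt ((1 - p) * (1 - q)) ≤ r := by
  have hp' : 0 < 1 - p := sub_pos.2 hp
  have hq' : 0 < 1 - q := sub_pos.2 hq
  have hlog : Real.log (Real.sqrt ((1 - p) * (1 - q))) =
      (Real.log (1 - p) + Real.log (1 - q)) / 2 := by
    rw [Real.log_sqrt (by positivity), Real.log_mul hp'.ne' hq'.ne']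
  rw [← neg_add, neg_div, neg_le_neg_iff, ← hlog,
    Real.log_le_log_iff (sub_pos.2 hr) (by positivity), sub_le_comm]

lemma forall_half_add_blockCost_le_iff {k : ℕ} {P : Matrix (Fin k) (Fin k) I}
    (hP_symm : P.IsSymm) (hP : ∀ i j, (P i j : ℝ) < 1) :
    (∀ i j, (blockCost P i i + blockCost P j j) / 2 ≤ blockCost P i j) ↔ ∀ i j : Fin k, i < j →
      (P i j : ℝ) ≥ 1 - Real.sqrt ((1 - (P i i : ℝ)) * (1 - (P j j : ℝ))) := by
  have hiff (i j : Fin k) := half_add_neg_log_le_iff (hP i i) (hP j j) (hP i j)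
  refine ⟨fun h i j _ => (hiff i j).1 (h i j), fun h i j => ?_⟩
  rcases lt_trichotomy i j with hij | rfl | hji
  · exact (hiff i j).2 (h i j hij)
  · rw [add_self_div_two]
  · rw [add_comm, blockCost, blockCost, blockCost, ← hP_symm.apply i j]
    exact (hiff j i).2 (h j i hji)

end BlockCost

section BlockRandom

lemma isBlockSequence_const {V : ℕ → Type*} [∀ n, Fintype (V n)] {q : I} {a : ℝ}
    (hV : ∀ n, Fintype.card (V n) ≤ n) (hq₀ : 0 < (q : ℝ)) (hq₁ : (q : ℝ) < 1)
    (ha : Tendsto (fun n => (Fintype.card (V n) : ℝ) / n) atTop (𝓝 a)) :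
    IsBlockSequence (V := V) (fun _ _ => q) (fun _ _ => ()) (fun _ _ => -Real.log (1 - q))
      fun _ => a where
  card_le := hV
  lt_one _ _ := hq₁
  cost_eq _ _ _ _ := rfl
  cost_pos _ := neg_log_one_sub_pos hq₀ hq₁
  tendsto_card _ := by simpa [part] using ha

variable {k : ℕ} {α : Fin k → ℝ} {P : Matrix (Fin k) (Fin k) I}

lemma card_part_fst (n : ℕ) (i : Fin k) :
    (part (Sigma.fst : BlockVertex α n → Fin k) i).card = blockSize α n i := by
  have hpart : part (Sigma.fst : BlockVertex α n → Fin k) i =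
      Finset.univ.map (Function.Embedding.sigmaMk i) := by
    ext ⟨j, x⟩
    simp only [mem_part, Finset.mem_map, Finset.mem_univ, true_and,
      Function.Embedding.sigmaMk_apply]
    exact ⟨by rintro rfl; exact ⟨x, rfl⟩, fun ⟨_, hy⟩ => (congrArg Sigma.fst hy).symm⟩
  rw [hpart, Finset.card_map, Finset.card_univ, Fintype.card_fin]

/-- The probabilities of the edges of `G(n, α, P)`, as in `blockRandom`. -/
def blockProb (α : Fin k → ℝ) (hP_symm : P.IsSymm) (n : ℕ) : Sym2 (BlockVertex α n) → I :=
  Sym2.lift ⟨fun u v => P u.1 v.1, fun u v => hP_symm.apply v.1 u.1⟩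

lemma isBlockSequence_blockProb (hα : ∀ i, 0 ≤ α i) (hsum : ∑ i, α i = 1) (hP_symm : P.IsSymm)
    (hP : ∀ i j, 0 < (P i j : ℝ) ∧ (P i j : ℝ) < 1) :
    IsBlockSequence (blockProb α hP_symm) (fun _ => Sigma.fst) (blockCost P) α where
  card_le n := by simp [sum_blockSize hα hsum]
  lt_one n e := by
    induction e with
    | _ u v => exact (hP u.1 v.1).2
  cost_eq _ _ _ _ := rfl
  cost_pos i := neg_log_one_sub_pos (hP i i).1 (hP i i).2
  tendsto_card i := by simpa only [card_part_fst] using tendsto_blockSize_div hα hsum i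

lemma isBlockSequence_blockSize (hα : ∀ i, 0 ≤ α i) (hsum : ∑ i, α i = 1)
    (hP : ∀ i j, 0 < (P i j : ℝ) ∧ (P i j : ℝ) < 1) (i : Fin k) :
    IsBlockSequence (V := fun n => Fin (blockSize α n i)) (fun _ _ => P i i) (fun _ _ => ())
      (fun _ _ => blockCost P i i) fun _ => α i :=
  isBlockSequence_const (by simpa using fun n => blockSize_le hα hsum n i) (hP i i).1 (hP i i).2
    (by simpa using tendsto_blockSize_div hα hsum i)

variable {Ω : ℕ → Type*} [∀ n, MeasurableSpace (Ω n)] {μ : ∀ n, Measure (Ω n)}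
  {H : ∀ n (i : Fin k), Ω n → SimpleGraph (Fin (blockSize α n i))}

theorem whpUpper_sum_chi_binomialRandom (hα : ∀ i, 0 ≤ α i) (hsum : ∑ i, α i = 1)
    (hP : ∀ i j, 0 < (P i j : ℝ) ∧ (P i j : ℝ) < 1) (hH : ∀ n i, HasLaw (H n i)
      (SimpleGraph.binomialRandom (Fin (blockSize α n i)) (P i i)) (μ n)) :
    WhpUpper μ chromaticScale (fun n ω => ∑ i, chi (H n i ω))
      ((∑ i, α i * blockCost P i i) / 2) := by
  simp only [binomialRandom_eq_independentEdges] at hH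
  rw [Finset.sum_div]
  refine WhpUpper.sum (fun i => ?_) chromaticScale_nonneg
  simpa using (isBlockSequence_blockSize hα hsum hP i).whpUpper_chi.comp_hasLaw fun n => hH n i

theorem whpLower_sum_chi_binomialRandom (hα : ∀ i, 0 ≤ α i) (hsum : ∑ i, α i = 1)
    (hP : ∀ i j, 0 < (P i j : ℝ) ∧ (P i j : ℝ) < 1) (hH : ∀ n i, HasLaw (H n i)
      (SimpleGraph.binomialRandom (Fin (blockSize α n i)) (P i i)) (μ n)) :
    WhpLower μ chromaticScale (fun n ω => ∑ i, chi (H n i ω))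
      ((∑ i, α i * blockCost P i i) / 2) := by
  simp only [binomialRandom_eq_independentEdges] at hH
  rw [Finset.sum_div]
  refine WhpLower.sum (fun i => ?_) chromaticScale_nonneg
  simpa using ((isBlockSequence_blockSize hα hsum hP i).whpLower_chi fun _ _ =>
    (add_self_div_two _).le).comp_hasLaw fun n => hH n i

end BlockRandom

end RandomBlockGraph

end

open RandomBlockGraph in
/-- For each `n`, the graphs `G n ∼ G(n, α, P)` and `H n i ∼ G(|V_i|, p_i)` live on one
probability space, with an arbitrary joint distribution. -/
theorem mainTheorem2 {k : ℕ} (α : Fin k → ℝ) (hα : ∀ i, 0 < α i ∧ α i ≤ 1) (hα_sum : ∑ i, α i = 1)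
    (P : Matrix (Fin k) (Fin k) unitInterval) (hP_symm : P.IsSymm)
    (hP : ∀ i j, 0 < (P i j : ℝ) ∧ (P i j : ℝ) < 1)
    {Ω : ℕ → Type*} [∀ n, MeasurableSpace (Ω n)] (μ : ∀ n, Measure (Ω n))
    [∀ n, IsProbabilityMeasure (μ n)]
    (G : ∀ n, Ω n → SimpleGraph (RandomBlockGraph.BlockVertex α n))
    (hG : ∀ n, HasLaw (G n) (RandomBlockGraph.blockRandom n α P hP_symm) (μ n))
    (H : ∀ n (i : Fin k), Ω n → SimpleGraph (Fin (RandomBlockGraph.blockSize α n i)))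
    (hH : ∀ n i, HasLaw (H n i)
      (SimpleGraph.binomialRandom (Fin (RandomBlockGraph.blockSize α n i)) (P i i)) (μ n)) :
    RandomBlockGraph.WhpAsymptoticallyEq μ (fun n ω => RandomBlockGraph.chi (G n ω))
        (fun n ω => ∑ i, RandomBlockGraph.chi (H n i ω)) ↔
      ∀ i j : Fin k, i < j →
        (P i j : ℝ) ≥ 1 - Real.sqrt ((1 - (P i i : ℝ)) * (1 - (P j j : ℝ))) := by
  have hα₀ (i : Fin k) : 0 ≤ α i := (hα i).1.le
  have hblock := isBlockSequence_blockProb hα₀ hα_sum hP_symm hP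
  have hHu := whpUpper_sum_chi_binomialRandom hα₀ hα_sum hP hH
  have hHl := whpLower_sum_chi_binomialRandom hα₀ hα_sum hP hH
  rw [← forall_half_add_blockCost_le_iff hP_symm fun i j => (hP i j).2]
  constructor
  · contrapose!
    rintro ⟨i, j, hlt⟩
    have hij : i ≠ j := by
      rintro rfl
      exact hlt.ne (add_self_div_two _).symm
    obtain ⟨ρ, hρ, hGu⟩ := hblock.exists_whpUpper_chi_lt hij hlt (hα i).1 (hα j).1
    exact not_whpAsymptoticallyEq_of_whpUpper_of_whpLower hρ eventually_chromaticScale_pos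
      (hGu.comp_hasLaw hG) hHl
  · intro hcost
    have : Nonempty (Fin k) := Fin.pos_iff_nonempty.1 (pos_of_sum_eq_one hα_sum)
    have hpos : 0 < (∑ i, α i * blockCost P i i) / 2 := half_pos <|
      Finset.sum_pos (fun i _ => mul_pos (hα i).1 (hblock.cost_pos i)) Finset.univ_nonempty
    exact whpAsymptoticallyEq_of_whpUpper_of_whpLower hpos (hblock.whpUpper_chi.comp_hasLaw hG)
      ((hblock.whpLower_chi hcost).comp_hasLaw hG) hHu hHl
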